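/- Let $\alpha\in(1,2]$ and let $Z$ be a random variable with values in $\{0,1,2,\dots\}$ and mean $\mathrm{E}Z=1$ (a critical offspring distribution) in the domain of attraction of a stable law of index $\alpha$; that is, there are $a_N>0$ such that $\frac{Z[N]-N}{a_N}\to X$ in distribution as $N\to\infty$, where $Z[N]$ is the sum of $N$ i.i.d. copies of $Z$ and $X$ is a real random variable with $\mathrm{E}e^{-\theta X}=e^{\theta^{\alpha}}$ for all $\theta\ge 0$. Let $\mathcal{T}$ be the Galton–Watson family tree with offspring distribution $Z$. For a family tree $T$, write $T_{\le k}$ for its first $k$ generations (generations $0,\dots,k$) and $T_k$ for the set of vertices of its $k$-th generation. Let $p_N=\mathrm{P}(\mathcal{T}_N\ne\emptyset)$ be the survival probability up to level $N$, and let $\ell$ be defined by $p_N=N^{-\frac{1}{\alpha-1}}\ell(N)$ for $N\ge 1$ (it is known that $\ell$ is slowly varying at infinity). Let $\mathcal{T}^*$ (the incipient infinite cluster) be the random family tree whose law $\mathbf{P}$ is the unique probability measure on family trees with $$\mathbf{P}(\mathcal{T}^*_{\le k}=T)=|T_k|\,\mathrm{P}(\mathcal{T}_{\le k}=T)$$ for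 all $k\ge 0$ and all family trees $T$ of $k$ generations. For a finite connected graph $G$, let $t_{\mathrm{cov}}(G)=\max_{x}E^x(\tau_{\mathrm{cov}})$, where $\tau_{\mathrm{cov}}$ is the first time at which the discrete-time simple random walk on $G$ has visited every vertex and $E^x$ is the expectation for the walk started at $x$. Then for every $\lambda\ge 1$, $$\liminf_{N\to\infty}\mathbf{P}\Big(t_{\mathrm{cov}}(\mathcal{T}^*_{\le N})\,N^{-\frac{2\alpha-1}{\alpha-1}}\,\ell(N)\ge\lambda\Big)>0 .$$ -/

import Mathlib

open MeasureTheory ProbabilityTheory Filter Topology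
open scoped ENNReal

/-! ## Random walk and cover time on a finite graph with unit weights -/

/-- One step of the simple random walk on a finite graph: from `x` move to a uniformly chosen
neighbour. (At an isolated vertex the walk stays put; in a connected graph this only concerns the
one-vertex graph.) -/
noncomputable def srwStep {V : Type*} [Finite V] (G : SimpleGraph V) (x : V) : PMF V :=
  open Classical in
  if h : (G.neighborSet x).toFinite.toFinset.Nonempty then
    PMF.uniformOfFinset (G.neighborSet x).toFinite.toFinset h
  else PMF.pure x

/-- The kernel giving the law of the position at time `n + 1` from the trajectory up to time `n`:
it only looks at the position at time `n`. -/
noncomputable def srwKernel {V : Type*} [Finite V] [MeasurableSpace V] [DiscreteMeasurableSpace V]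
    (G : SimpleGraph V) (n : ℕ) : Kernel ((i : Finset.Iic n) → V) V :=
  (⟨fun x => (srwStep G x).toMeasure, Measurable.of_discrete⟩ : Kernel V V).comap
    (fun h => h ⟨n, Finset.mem_Iic.2 le_rfl⟩) (measurable_pi_apply _)

instance {V : Type*} [Finite V] [MeasurableSpace V] [DiscreteMeasurableSpace V]
    (G : SimpleGraph V) (n : ℕ) : IsMarkovKernel (srwKernel G n) :=
  ⟨fun h => inferInstanceAs
    (IsProbabilityMeasure (srwStep G (h ⟨n, Finset.mem_Iic.2 le_rfl⟩)).toMeasure)⟩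

/-- The law, on the space of trajectories `ℕ → V`, of the simple random walk started at `x`. -/
noncomputable def srwLaw {V : Type*} [Finite V] [MeasurableSpace V] [DiscreteMeasurableSpace V]
    (G : SimpleGraph V) (x : V) : Measure (ℕ → V) :=
  Kernel.trajMeasure (X := fun _ => V) (Measure.dirac x) (srwKernel G)

/-- The first time at which the trajectory `X` has visited every vertex (`∞` if there is none). -/
noncomputable def coverTimeOf {V : Type*} (X : ℕ → V) : ℝ≥0∞ :=
  ⨅ (n : ℕ) (_ : ∀ v : V, ∃ m ≤ n, X m = v), (n : ℝ≥0∞)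

/-- The cover time `t_cov(G) = max_x E^x (τ_cov)` of the simple random walk on `G`. -/
noncomputable def coverTime {V : Type*} [Finite V] [MeasurableSpace V] [DiscreteMeasurableSpace V]
    (G : SimpleGraph V) : ℝ≥0∞ :=
  ⨆ x : V, ∫⁻ X, coverTimeOf X ∂(srwLaw G x)

/-! ## Family trees -/

/-- A rooted ordered locally finite tree (family tree), as a set of Ulam–Harris labels.
The root is `[]`, and `i :: u` is the `i`-th child (`i = 0, 1, …`) of `u`; thus the length of a
label is its generation, and the labels list the birth ranks with the most recent one first. -/
@[ext]
structure FamilyTree where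
  verts : Set (List ℕ)
  root_mem : [] ∈ verts
  parent_mem : ∀ (i : ℕ) (u : List ℕ), i :: u ∈ verts → u ∈ verts
  children : ∀ u ∈ verts, ∃ n : ℕ, ∀ i : ℕ, i :: u ∈ verts ↔ i < n

namespace FamilyTree

/-- The `k`-th generation of `t`. -/
def level (t : FamilyTree) (k : ℕ) : Set (List ℕ) := {u | u ∈ t.verts ∧ u.length = k}

/-- The first `k` generations of `t` (generations `0, …, k`). -/
def upTo (t : FamilyTree) (k : ℕ) : Set (List ℕ) := {u | u ∈ t.verts ∧ u.length ≤ k}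

/-- The `σ`-algebra on family trees generated by the events that a given vertex is present. -/
instance : MeasurableSpace FamilyTree :=
  MeasurableSpace.generateFrom {A | ∃ u : List ℕ, A = {t : FamilyTree | u ∈ t.verts}}

/-- The vertices of the first `N` generations, as a type. -/
def UpTo (t : FamilyTree) (N : ℕ) : Type := {u : List ℕ // u ∈ t.upTo N}

instance (t : FamilyTree) (N : ℕ) : MeasurableSpace (t.UpTo N) := ⊤

instance (t : FamilyTree) (N : ℕ) : DiscreteMeasurableSpace (t.UpTo N) := ⟨fun _ => trivial⟩

/-- The tree `t_{≤ N}` as a graph: each vertex is joined to its children. -/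
def graphUpTo (t : FamilyTree) (N : ℕ) : SimpleGraph (t.UpTo N) where
  Adj u v := (∃ i : ℕ, v.1 = i :: u.1) ∨ (∃ i : ℕ, u.1 = i :: v.1)
  symm := ⟨fun _ _ h => h.symm⟩
  loopless := ⟨fun u h => by
    rcases h with ⟨i, h⟩ | ⟨i, h⟩ <;> simpa using congrArg List.length h⟩

theorem finite_level (t : FamilyTree) (k : ℕ) : (t.level k).Finite := by
  induction k with
  | zero =>
    refine (Set.finite_singleton ([] : List ℕ)).subset ?_
    rintro u ⟨-, hu⟩
    simpa using hu
  | succ k ih =>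
    have h : t.level (k + 1) ⊆ ⋃ u ∈ t.level k, {w | w ∈ t.verts ∧ ∃ i : ℕ, w = i :: u} := by
      rintro w ⟨hw, hl⟩
      cases w with
      | nil => simp at hl
      | cons i u =>
        simp only [List.length_cons, Nat.add_right_cancel_iff] at hl
        exact Set.mem_biUnion (show u ∈ t.level k from ⟨t.parent_mem i u hw, hl⟩) ⟨hw, i, rfl⟩
    refine (ih.biUnion fun u hu => ?_).subset h
    obtain ⟨n, hn⟩ := t.children u hu.1
    refine ((Set.finite_lt_nat n).image (fun i => i :: u)).subset ?_
    rintro w ⟨hw, i, rfl⟩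
    exact ⟨i, (hn i).1 hw, rfl⟩

theorem finite_upTo (t : FamilyTree) (k : ℕ) : (t.upTo k).Finite := by
  refine ((Set.finite_le_nat k).biUnion fun j _ => t.finite_level j).subset ?_
  rintro u ⟨hu, hl⟩
  exact Set.mem_biUnion (show u.length ∈ {j | j ≤ k} from hl) ⟨hu, rfl⟩

instance (t : FamilyTree) (N : ℕ) : Finite (t.UpTo N) := (t.finite_upTo N).to_subtype

/-- The labels of the family tree in which the vertex `u` has `f u` children. -/
def memOfOffspring (f : List ℕ → ℕ) : List ℕ → Prop
  | [] => True
  | i :: u => memOfOffspring f u ∧ i < f u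

/-- The family tree in which the vertex `u` has `f u` children. -/
def ofOffspring (f : List ℕ → ℕ) : FamilyTree where
  verts := {u | memOfOffspring f u}
  root_mem := trivial
  parent_mem _ _ h := h.1
  children u hu := ⟨f u, fun _ => ⟨fun h => h.2, fun h => ⟨hu, h⟩⟩⟩

theorem measurable_ofOffspring : Measurable ofOffspring := by
  refine measurable_generateFrom ?_
  rintro _ ⟨u, rfl⟩
  induction u with
  | nil => exact MeasurableSet.univ
  | cons i u ih =>
    exact ih.inter (measurableSet_lt measurable_const (measurable_pi_apply u))

end FamilyTree

/-! ## Galton–Watson trees -/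

/-- The law of the Galton–Watson family tree with offspring distribution `ν`: the vertices have
independent numbers of children, all with law `ν`. -/
noncomputable def gwLaw (ν : PMF ℕ) : Measure FamilyTree :=
  (Measure.infinitePi fun _ : List ℕ => ν.toMeasure).map FamilyTree.ofOffspring

/-- The survival probability `p_N = P(Z_N > 0)`, where `Z_N` is the size of generation `N`. -/
noncomputable def survivalProb (ν : PMF ℕ) (N : ℕ) : ℝ :=
  (gwLaw ν).real {t | 0 < (t.level N).ncard}

/-- The offspring distribution `ν` is critical: its mean is `1`. -/
def IsCritical (ν : PMF ℕ) : Prop := ∑' n : ℕ, (n : ℝ≥0∞) * ν n = 1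

/-- The mean-one distribution `ν` lies in the domain of attraction of a stable law of index `α`:
for some normalisation `a`, the centred sums `(ξ_1 + ⋯ + ξ_n - n) / a_n` of independent variables
with law `ν` converge in distribution to a law `ρ` with Laplace transform
`E e^{-θ X} = e^{θ^α}`, `θ ≥ 0`. -/
def InStableDomain (α : ℝ) (ν : PMF ℕ) : Prop :=
  ∃ a : ℕ → ℝ, (∀ n, 0 < a n) ∧ ∃ ρ : ProbabilityMeasure ℝ,
    (∀ θ : ℝ, 0 ≤ θ → Integrable (fun x : ℝ => Real.exp (-θ * x)) (ρ : Measure ℝ) ∧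
      ∫ x : ℝ, Real.exp (-θ * x) ∂(ρ : Measure ℝ) = Real.exp (θ ^ α)) ∧
    TendstoInDistribution
      (fun (n : ℕ) (ξ : ℕ → ℕ) => ((∑ i ∈ Finset.range n, (ξ i : ℝ)) - n) / a n) atTop
      (id : ℝ → ℝ) (fun _ => Measure.infinitePi fun _ : ℕ => ν.toMeasure) (ρ : Measure ℝ)

/-! ## The incipient infinite cluster -/

/-- `P` is the law of the incipient infinite cluster: for every `k` and every family tree `S` of
`k` generations (given as the first `k` generations of some family tree),
`P(T*_{≤ k} = S) = |S_k| P(T_{≤ k} = S)`, where `T` is the Galton–Watson tree. -/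
def IsIICLaw (ν : PMF ℕ) (P : Measure FamilyTree) : Prop :=
  IsProbabilityMeasure P ∧ ∀ (k : ℕ) (S : FamilyTree),
    P {t | t.upTo k = S.upTo k} = (S.level k).ncard * gwLaw ν {t | t.upTo k = S.upTo k}


namespace FamilyTree

theorem measurableSet_mem (u : List ℕ) : MeasurableSet {t : FamilyTree | u ∈ t.verts} :=
  MeasurableSpace.measurableSet_generateFrom ⟨u, rfl⟩

theorem measurableSet_upTo_eq (k : ℕ) (s : Set (List ℕ)) :
    MeasurableSet {t : FamilyTree | t.upTo k = s} := by
  have h : {t : FamilyTree | t.upTo k = s} =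
      ⋂ u : List ℕ, {t : FamilyTree | (u ∈ t.verts ∧ u.length ≤ k) ↔ u ∈ s} := by
    ext t
    simp only [Set.mem_iInter]
    exact Set.ext_iff
  rw [h]
  exact MeasurableSet.iInter fun u =>
    ((measurableSet_mem u).inter (MeasurableSet.const _)).iff (MeasurableSet.const _)

theorem exists_eq_ofOffspring (S : FamilyTree) : ∃ c, S = ofOffspring c := by
  classical
  choose n hn using S.children
  refine ⟨fun u => if h : u ∈ S.verts then n u h else 0, ?_⟩
  ext u
  induction u with
  | nil => exact ⟨fun _ => trivial, fun _ => S.root_mem⟩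
  | cons i u ih =>
    constructor
    · intro h
      have hu := S.parent_mem i u h
      refine ⟨ih.1 hu, ?_⟩
      simp only [hu, dif_pos]
      exact (hn u hu i).1 h
    · rintro ⟨h1, h2⟩
      have hu := ih.2 h1
      simp only [hu, dif_pos] at h2
      exact (hn u hu i).2 h2

theorem upTo_ofOffspring_eq_iff (f c : List ℕ → ℕ) (k : ℕ) :
    (ofOffspring f).upTo k = (ofOffspring c).upTo k ↔
      ∀ u, memOfOffspring c u → u.length < k → f u = c u := by
  constructor
  · intro h u hu hk
    have hu' : u ∈ (ofOffspring f).upTo k := by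
      rw [h]; exact ⟨hu, hk.le⟩
    have key : ∀ i, i < f u ↔ i < c u := fun i => by
      have := Set.ext_iff.1 h (i :: u)
      have h1 : i :: u ∈ (ofOffspring f).upTo k ↔ i < f u :=
        ⟨fun h => h.1.2, fun h => ⟨⟨hu'.1, h⟩, hk⟩⟩
      have h2 : i :: u ∈ (ofOffspring c).upTo k ↔ i < c u :=
        ⟨fun h => h.1.2, fun h => ⟨⟨hu, h⟩, hk⟩⟩
      rw [← h1, ← h2, this]
    apply le_antisymm
    · by_contra! h; exact lt_irrefl _ ((key _).1 h)
    · by_contra! h; exact lt_irrefl _ ((key _).2 h)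
  · intro h
    have key : ∀ u : List ℕ, u.length ≤ k → (memOfOffspring f u ↔ memOfOffspring c u) := by
      intro u
      induction u with
      | nil => intro _; exact Iff.rfl
      | cons i u ih =>
        intro hk
        simp only [List.length_cons] at hk
        change _ ∧ _ ↔ _ ∧ _
        rw [ih (by omega)]
        refine and_congr_right fun hu => ?_
        rw [h u hu (by omega)]
    ext u
    exact and_congr_left fun hk => key u hk

end FamilyTree

open FamilyTree

/-- The vertices of the first `k - 1` generations. -/
noncomputable def innerVerts (c : List ℕ → ℕ) (k : ℕ) : Finset (List ℕ) :=
  ((ofOffspring c).finite_upTo k).toFinset.filter fun u => u.length < k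

theorem mem_innerVerts (c : List ℕ → ℕ) (k : ℕ) (u : List ℕ) :
    u ∈ innerVerts c k ↔ memOfOffspring c u ∧ u.length < k := by
  rw [innerVerts, Finset.mem_filter, Set.Finite.mem_toFinset]
  exact ⟨fun h => ⟨h.1.1, h.2⟩, fun h => ⟨⟨h.1, h.2.le⟩, h.2⟩⟩

theorem gwLaw_upTo_eq (ν : PMF ℕ) (c : List ℕ → ℕ) (k : ℕ) :
    gwLaw ν {t | t.upTo k = (ofOffspring c).upTo k} = ∏ u ∈ innerVerts c k, ν (c u) := by
  rw [gwLaw, Measure.map_apply measurable_ofOffspring (measurableSet_upTo_eq _ _)]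
  have h : ofOffspring ⁻¹' {t | t.upTo k = (ofOffspring c).upTo k} =
      Set.pi (innerVerts c k) (fun u => {c u}) := by
    ext f
    simp only [Set.mem_preimage, Set.mem_ofPred_eq, upTo_ofOffspring_eq_iff, Set.mem_pi,
      SetLike.mem_coe, mem_innerVerts, Set.mem_singleton_iff, and_imp]
  rw [h, Measure.infinitePi_pi _ (fun _ _ => MeasurableSet.of_discrete)]
  exact Finset.prod_congr rfl fun u _ => PMF.toMeasure_apply_singleton _ _ (.of_discrete)

theorem isProbabilityMeasure_gwLaw (ν : PMF ℕ) : IsProbabilityMeasure (gwLaw ν) :=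
  Measure.isProbabilityMeasure_map measurable_ofOffspring.aemeasurable

/-- Joint law of the number of children of a spine vertex and of the rank of the next one. -/
noncomputable def spineStep (ν : PMF ℕ) (hν : IsCritical ν) : PMF (ℕ × ℕ) :=
  ⟨fun p => if p.2 < p.1 then ν p.1 else 0, by
    have h : ∑' p : ℕ × ℕ, (if p.2 < p.1 then ν p.1 else 0) = 1 := by
      rw [ENNReal.tsum_prod', ← hν]
      refine tsum_congr fun n => ?_
      rw [tsum_eq_sum (s := Finset.range n)]
      · rw [Finset.sum_congr rfl (g := fun _ => ν n)]
        · simp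
        · intro j hj
          simp [Finset.mem_range.1 hj]
      · intro j hj
        have : ¬ j < n := fun h => hj (Finset.mem_range.2 h)
        simp [this]
    rw [← h]
    exact ENNReal.summable.hasSum⟩

/-- The vertex `u` lies on the spine prescribed by the ranks `(η i).2`. -/
def OnSpine (η : ℕ → ℕ × ℕ) : List ℕ → Prop
  | [] => True
  | i :: u => OnSpine η u ∧ (η u.length).2 = i

open Classical in
/-- Numbers of children in the tree with a distinguished spine. -/
noncomputable def spineOffspring (ω : (List ℕ → ℕ) × (ℕ → ℕ × ℕ)) (u : List ℕ) : ℕ :=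
  if OnSpine ω.2 u then (ω.2 u.length).1 else ω.1 u

theorem measurableSet_onSpine (u : List ℕ) :
    MeasurableSet {ω : (List ℕ → ℕ) × (ℕ → ℕ × ℕ) | OnSpine ω.2 u} := by
  induction u with
  | nil => exact MeasurableSet.univ
  | cons i u ih =>
    refine ih.inter ?_
    have : Measurable fun ω : (List ℕ → ℕ) × (ℕ → ℕ × ℕ) => (ω.2 u.length).2 := by fun_prop
    exact this (measurableSet_singleton i)

theorem measurable_spineOffspring : Measurable spineOffspring := by
  classical
  refine measurable_pi_iff.2 fun u => ?_
  exact Measurable.ite (measurableSet_onSpine u) (by fun_prop) (by fun_prop)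

theorem OnSpine.unique {η : ℕ → ℕ × ℕ} : ∀ {u v : List ℕ}, OnSpine η u → OnSpine η v →
    u.length = v.length → u = v
  | [], [], _, _, _ => rfl
  | [], _ :: _, _, _, h => by simp at h
  | _ :: _, [], _, _, h => by simp at h
  | i :: u, j :: v, hu, hv, h => by
    have h' : u.length = v.length := by simpa using h
    obtain rfl := OnSpine.unique hu.1 hv.1 h'
    rw [← hu.2, ← hv.2]

theorem OnSpine.suffix {η : ℕ → ℕ × ℕ} : ∀ {u v : List ℕ}, OnSpine η (u ++ v) → OnSpine η v
  | [], _, h => h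
  | _ :: _, _, h => OnSpine.suffix h.1

theorem onSpine_iff {η : ℕ → ℕ × ℕ} (v : List ℕ) :
    OnSpine η v ↔ ∀ i ∈ Finset.range v.length, (η i).2 = v.reverse.getD i 0 := by
  induction v with
  | nil => simp [OnSpine]
  | cons j v ih =>
    rw [List.length_cons, Finset.range_add_one]
    simp only [Finset.forall_mem_insert, OnSpine, ih, List.reverse_cons]
    rw [and_comm]
    refine and_congr (by simp) ?_
    refine forall₂_congr fun i hi => ?_
    rw [List.getD_append _ _ _ _ (by simpa using hi)]

theorem exists_onSpine (c : List ℕ → ℕ) (η : ℕ → ℕ × ℕ) (h : ∀ i, (η i).2 < (η i).1)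
    (k : ℕ) (hc : ∀ u, memOfOffspring c u → u.length < k → OnSpine η u → c u = (η u.length).1) :
    ∃ v, memOfOffspring c v ∧ v.length = k ∧ OnSpine η v := by
  induction k with
  | zero => exact ⟨[], trivial, rfl, trivial⟩
  | succ k ih =>
    obtain ⟨v, h1, h2, h3⟩ := ih fun u hu hk => hc u hu (by omega)
    refine ⟨(η k).2 :: v, ⟨h1, ?_⟩, by simp [h2], h3, by rw [h2]⟩
    rw [hc v h1 (by omega) h3, h2]
    exact h k

theorem memOfOffspring_suffix {c : List ℕ → ℕ} : ∀ {u v : List ℕ},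
    memOfOffspring c (u ++ v) → memOfOffspring c v
  | [], _, h => h
  | _ :: _, _, h => memOfOffspring_suffix h.1

/-- The ancestor of `v` in generation `i`. -/
def ancestor (v : List ℕ) (i : ℕ) : List ℕ := v.drop (v.length - i)

theorem ancestor_length {v : List ℕ} {i : ℕ} (h : i ≤ v.length) : (ancestor v i).length = i := by
  simp [ancestor]; omega

theorem ancestor_suffix (v : List ℕ) (i : ℕ) : ancestor v i <:+ v := List.drop_suffix _ _

theorem ancestor_of_suffix {u v : List ℕ} (h : u <:+ v) : ancestor v u.length = u := by
  obtain ⟨w, rfl⟩ := h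
  simp [ancestor]

theorem ancestor_succ {v : List ℕ} {i : ℕ} (h : i < v.length) :
    ancestor v (i + 1) = v.reverse.getD i 0 :: ancestor v i := by
  unfold ancestor
  rw [List.drop_eq_getElem_cons (by omega)]
  congr 1
  · rw [List.getD_eq_getElem _ _ (by simpa using h), List.getElem_reverse]
    congr 1
    omega
  · congr 1; omega

theorem ancestor_mem {c : List ℕ → ℕ} {v : List ℕ} (hv : memOfOffspring c v) (i : ℕ) :
    memOfOffspring c (ancestor v i) := by
  obtain ⟨w, hw⟩ := ancestor_suffix v i
  rw [← hw] at hv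
  exact memOfOffspring_suffix hv

/-- The law of the independent variables that produce the tree with a spine. -/
noncomputable def spineLaw (ν : PMF ℕ) (hν : IsCritical ν) :
    Measure ((List ℕ → ℕ) × (ℕ → ℕ × ℕ)) :=
  (Measure.infinitePi fun _ : List ℕ => ν.toMeasure).prod
    (Measure.infinitePi fun _ : ℕ => (spineStep ν hν).toMeasure)

theorem spineLaw_event (ν : PMF ℕ) (hν : IsCritical ν) (c : List ℕ → ℕ) (v : List ℕ)
    (hv : memOfOffspring c v) :
    spineLaw ν hν {ω | OnSpine ω.2 v ∧
      (ofOffspring (spineOffspring ω)).upTo v.length = (ofOffspring c).upTo v.length} =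
      ∏ u ∈ innerVerts c v.length, ν (c u) := by
  classical
  set k := v.length with hk
  set D := innerVerts c k with hD
  have hset : {ω : (List ℕ → ℕ) × (ℕ → ℕ × ℕ) | OnSpine ω.2 v ∧
      (ofOffspring (spineOffspring ω)).upTo k = (ofOffspring c).upTo k} =
      (Set.pi (D.filter fun u => ¬ u <:+ v : Finset (List ℕ)) (fun u => {c u})) ×ˢ
      (Set.pi (Finset.range k : Finset ℕ)
        (fun i => {(c (ancestor v i), v.reverse.getD i 0)})) := by
    ext ω
    simp only [Set.mem_ofPred_eq, upTo_ofOffspring_eq_iff, Set.mem_prod, Set.mem_pi,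
      SetLike.mem_coe, Finset.mem_filter, hD, mem_innerVerts, Set.mem_singleton_iff]
    have hsp : OnSpine ω.2 v → ∀ u : List ℕ, u.length < k → (OnSpine ω.2 u ↔ u <:+ v) := by
      intro h u hu
      constructor
      · intro h1
        obtain ⟨w, hw⟩ := ancestor_suffix v u.length
        have h2 : OnSpine ω.2 (ancestor v u.length) := by
          rw [← hw] at h; exact h.suffix
        rw [h1.unique h2 (ancestor_length hu.le).symm]
        exact ancestor_suffix _ _
      · rintro ⟨w, hw⟩
        rw [← hw] at h; exact h.suffix
    constructor
    · rintro ⟨h1, h2⟩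
      refine ⟨?_, ?_⟩
      · rintro u ⟨⟨hu, hl⟩, hs⟩
        have := h2 u hu hl
        rwa [spineOffspring, if_neg (by rwa [hsp h1 u hl])] at this
      · intro i hi
        have hi' : i < k := by simpa using hi
        have hl := ancestor_length (v := v) (i := i) hi'.le
        refine Prod.ext ?_ ((onSpine_iff v).1 h1 i hi)
        have := h2 (ancestor v i) (ancestor_mem hv i) (by omega)
        rw [spineOffspring, if_pos ((hsp h1 _ (by omega)).2 (ancestor_suffix v i)), hl] at this
        exact this
    · rintro ⟨h1, h2⟩
      have h3 : OnSpine ω.2 v := (onSpine_iff v).2 fun i hi => by rw [h2 i hi]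
      refine ⟨h3, fun u hu hl => ?_⟩
      by_cases hs : u <:+ v
      · rw [spineOffspring, if_pos ((hsp h3 u hl).2 hs), h2 _ (by simpa using hl),
          ancestor_of_suffix hs]
      · rw [spineOffspring, if_neg (by rwa [hsp h3 u hl])]
        exact h1 u ⟨⟨hu, hl⟩, hs⟩
  rw [hset, spineLaw, Measure.prod_prod,
    Measure.infinitePi_pi _ (fun _ _ => MeasurableSet.of_discrete),
    Measure.infinitePi_pi _ (fun _ _ => MeasurableSet.of_discrete)]
  simp only [PMF.toMeasure_apply_singleton _ _ (MeasurableSet.of_discrete)]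
  have hstep : ∀ i ∈ Finset.range k,
      spineStep ν hν (c (ancestor v i), v.reverse.getD i 0) = ν (c (ancestor v i)) := by
    intro i hi
    have hi' : i < k := by simpa using hi
    have h1 := ancestor_mem hv (i + 1)
    rw [ancestor_succ hi'] at h1
    exact if_pos h1.2
  rw [Finset.prod_congr rfl hstep, ← Finset.prod_filter_mul_prod_filter_not D (fun u => u <:+ v),
    mul_comm]
  congr 1
  refine Finset.prod_bij' (fun i _ => ancestor v i) (fun u _ => u.length) ?_ ?_ ?_ ?_ ?_
  · intro i hi
    have hi' : i < k := by simpa using hi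
    rw [Finset.mem_filter, hD, mem_innerVerts, ancestor_length hi'.le]
    exact ⟨⟨ancestor_mem hv i, hi'⟩, ancestor_suffix v i⟩
  · intro u hu
    rw [Finset.mem_filter, hD, mem_innerVerts] at hu
    simpa using hu.1.2
  · intro i hi
    have hi' : i < k := by simpa using hi
    exact ancestor_length hi'.le
  · intro u hu
    exact ancestor_of_suffix (Finset.mem_filter.1 hu).2
  · intros; rfl

theorem exists_isIICLaw (ν : PMF ℕ) (hν : IsCritical ν) : ∃ P, IsIICLaw ν P := by
  have hm : Measurable fun ω => ofOffspring (spineOffspring ω) :=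
    measurable_ofOffspring.comp measurable_spineOffspring
  have : IsProbabilityMeasure (spineLaw ν hν) := by unfold spineLaw; infer_instance
  refine ⟨(spineLaw ν hν).map fun ω => ofOffspring (spineOffspring ω),
    Measure.isProbabilityMeasure_map hm.aemeasurable, fun k S => ?_⟩
  obtain ⟨c, rfl⟩ := exists_eq_ofOffspring S
  rw [Measure.map_apply hm (measurableSet_upTo_eq _ _), gwLaw_upTo_eq]
  set L := (ofOffspring c).finite_level k |>.toFinset with hL
  have hae : ∀ᵐ ω ∂(spineLaw ν hν), ∀ i, (ω.2 i).2 < (ω.2 i).1 := by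
    rw [ae_all_iff]
    intro i
    have h1 : ∀ᵐ η ∂(Measure.infinitePi fun _ : ℕ => (spineStep ν hν).toMeasure),
        (η i).2 < (η i).1 := by
      have h2 : ∀ᵐ p ∂((spineStep ν hν).toMeasure), p.2 < p.1 := by
        rw [ae_iff, PMF.toMeasure_apply_eq_zero_iff _ (MeasurableSet.of_discrete),
          Set.disjoint_left]
        intro p hp hp'
        exact hp (if_neg hp')
      exact (measurePreserving_eval_infinitePi
        (fun _ : ℕ => (spineStep ν hν).toMeasure) i).quasiMeasurePreserving.ae h2
    exact Measure.quasiMeasurePreserving_snd.ae h1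
  have hunion : (fun ω => ofOffspring (spineOffspring ω)) ⁻¹'
        {t | t.upTo k = (ofOffspring c).upTo k} =ᵐ[spineLaw ν hν]
      ⋃ v ∈ L, {ω | OnSpine ω.2 v ∧
        (ofOffspring (spineOffspring ω)).upTo k = (ofOffspring c).upTo k} := by
    filter_upwards [hae] with ω hω
    refine propext ?_
    change (ofOffspring (spineOffspring ω)).upTo k = (ofOffspring c).upTo k ↔
      ω ∈ ⋃ v ∈ L, {ω | OnSpine ω.2 v ∧
        (ofOffspring (spineOffspring ω)).upTo k = (ofOffspring c).upTo k}
    simp only [Set.mem_iUnion, Set.mem_ofPred_eq, exists_prop]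
    constructor
    · intro h
      have h' := (upTo_ofOffspring_eq_iff _ _ _).1 h
      obtain ⟨v, h1, h2, h3⟩ := exists_onSpine c ω.2 hω k fun u hu hl hs => by
        rw [← h' u hu hl, spineOffspring, if_pos hs]
      exact ⟨v, by rw [hL, Set.Finite.mem_toFinset]; exact ⟨h1, h2⟩, h3, h⟩
    · rintro ⟨v, _, _, h⟩
      exact h
  rw [measure_congr hunion, measure_biUnion_finset]
  · have hterm : ∀ v ∈ L, spineLaw ν hν {ω | OnSpine ω.2 v ∧
        (ofOffspring (spineOffspring ω)).upTo k = (ofOffspring c).upTo k} =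
        ∏ u ∈ innerVerts c k, ν (c u) := by
      intro v hv
      rw [hL, Set.Finite.mem_toFinset] at hv
      obtain ⟨h1, rfl⟩ := hv
      exact spineLaw_event ν hν c v h1
    rw [Finset.sum_congr rfl hterm, Finset.sum_const, nsmul_eq_mul,
      Set.ncard_eq_toFinset_card _ ((ofOffspring c).finite_level k)]
  · intro v hv w hw hvw
    rw [hL, Finset.mem_coe, Set.Finite.mem_toFinset] at hv hw
    refine Set.disjoint_left.2 fun ω h1 h2 => hvw (h1.1.unique h2.1 (hv.2.trans hw.2.symm))
  · intro v _
    exact (measurableSet_onSpine v).inter (hm (measurableSet_upTo_eq _ _))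

theorem IsIICLaw.unique {ν : PMF ℕ} {P Q : Measure FamilyTree} (hP : IsIICLaw ν P)
    (hQ : IsIICLaw ν Q) : P = Q := by
  have := hP.1
  have := hQ.1
  have hmono : ∀ {k l : ℕ} {s t : FamilyTree}, k ≤ l → s.upTo l = t.upTo l →
      s.upTo k = t.upTo k := by
    intro k l s t hkl h
    ext u
    have := Set.ext_iff.1 h u
    constructor
    · rintro ⟨h1, h2⟩; exact ⟨(this.1 ⟨h1, h2.trans hkl⟩).1, h2⟩
    · rintro ⟨h1, h2⟩; exact ⟨(this.2 ⟨h1, h2.trans hkl⟩).1, h2⟩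
  set C : Set (Set FamilyTree) := {A | ∃ (k : ℕ) (S : FamilyTree), A = {t | t.upTo k = S.upTo k}}
    with hC
  refine ext_of_generate_finite C ?_ ?_ ?_ (by simp)
  · apply le_antisymm
    · refine MeasurableSpace.generateFrom_le ?_
      rintro _ ⟨u, rfl⟩
      have hcount : (Set.range fun S : FamilyTree => S.upTo u.length).Countable :=
        (Set.Countable.ofPred_finite (α := List ℕ)).mono (by
          rintro _ ⟨S, rfl⟩; exact S.finite_upTo _)
      have hset : {t : FamilyTree | u ∈ t.verts} =
          ⋃ s ∈ (Set.range fun S : FamilyTree => S.upTo u.length) ∩ {s | u ∈ s},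
            {t : FamilyTree | t.upTo u.length = s} := by
        ext t
        simp only [Set.mem_iUnion, Set.mem_ofPred_eq, exists_prop, exists_eq_right',
          Set.mem_inter_iff]
        exact ⟨fun h => ⟨⟨t, rfl⟩, h, le_rfl⟩, fun h => h.2.1⟩
      rw [hset]
      refine MeasurableSet.biUnion (hcount.mono Set.inter_subset_left) ?_
      rintro s ⟨⟨S, rfl⟩, -⟩
      exact MeasurableSpace.measurableSet_generateFrom ⟨u.length, S, rfl⟩
    · refine MeasurableSpace.generateFrom_le ?_
      rintro _ ⟨k, S, rfl⟩
      exact measurableSet_upTo_eq _ _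
  · rintro _ ⟨k, S, rfl⟩ _ ⟨l, T, rfl⟩ ⟨r, hr1, hr2⟩
    simp only [Set.mem_ofPred_eq] at hr1 hr2
    refine ⟨max k l, r, ?_⟩
    ext t
    simp only [Set.mem_inter_iff, Set.mem_ofPred_eq, ← hr1, ← hr2]
    refine ⟨fun ⟨h1, h2⟩ => ?_, fun h => ⟨hmono (le_max_left _ _) h, hmono (le_max_right _ _) h⟩⟩
    rcases le_total k l with h | h
    · rwa [max_eq_right h]
    · rwa [max_eq_left h]
  · rintro _ ⟨k, S, rfl⟩
    rw [hP.2, hQ.2]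

theorem existsUnique_isIICLaw (ν : PMF ℕ) (hν : IsCritical ν) : ∃! P, IsIICLaw ν P := by
  obtain ⟨P, hP⟩ := exists_isIICLaw ν hν
  exact ⟨P, hP, fun Q hQ => hQ.unique hP⟩

/-- The law of the incipient infinite cluster `T*` of the critical Galton–Watson tree with
offspring distribution `ν`: the unique probability measure `P` with `IsIICLaw ν P`. -/
noncomputable def iicLaw (ν : PMF ℕ) (hν : IsCritical ν) : Measure FamilyTree :=
  (existsUnique_isIICLaw ν hν).choose

theorem isIICLaw_iicLaw (ν : PMF ℕ) (hν : IsCritical ν) : IsIICLaw ν (iicLaw ν hν) :=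
  (existsUnique_isIICLaw ν hν).choose_spec.1

/-! ## Hitting times of the simple random walk -/

section RandomWalk

/-! Since `p_N = N^{-1/(α-1)} ℓ(N)`, the normalising factor is `p_N / N²`, so the cover time has to
exceed `λ N² / p_N` with probability bounded below. Two estimates give this.

Deterministic estimate: in a tree, the commute time between the root and a vertex at depth `N` is `2
· #edges · N`, so one of the two hitting times, and with it the cover time, is at least `#edges · N`
(`ofReal_edges_mul_le_coverTime`). The hitting times are bounded below by explicit potentials. It
remains to make the volume of the first `N` generations exceed `λ N / p_N + 1`.

Probabilistic estimate: the first `N` generations of the cluster have the Galton–Watson law weighted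
by `Z_N`. Hence a Galton–Watson event of probability at least `ε p_N`, on which `Z_N ≥ b / p_N` and
the volume is large, has probability at least `b ε` for the cluster (`exists_le_iicLaw`). To find
this event (`exists_le_gwLaw`), take about `1/p_N` individuals near generation `N/3`, which exist
with probability of order `p_N`, and divide them into `K + 1` independent blocks. With probability
bounded below a block contains a tree of volume of order `N/p_N`; the last block is used instead to
populate generation `N`. So `K` blocks beat any `λ`, at the fixed cost `d^(K+1)`.

This requires `p_n` and `p_{5n}` to be comparable. With `g(s) = (f(1-s) - (1-s))/s` (`excess`),
criticality gives `p_{n+1} = p_n (1 - g(p_n))`. If `g(bs) ≥ 2 g(s)` near `0`, then `n g(p_n)` is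
bounded and `p` decays at most polynomially (`exists_mul_le_of_recursion`).

The growth of `g` (`excess_growth`) comes from `E e^{-t(S_n - n)} = (1 + r)^n`, where `r` is
essentially `s g(s)` at `s = 1 - e^{-t}`. Convergence in law bounds `n r` below by `θ^α - 1` at `t =
θ/a_n`. Conversely, if `n r` lies in `[3, 4]`, a second-moment argument and tightness force `t` to
be at least a constant times `1/a_n`. As `α > 1`, the function `θ^α` beats every linear function,
and comparing the two scales gives the growth. No theory of regular variation is needed. -/

theorem measurableSet_avoid {V : Type*} [MeasurableSpace V] [DiscreteMeasurableSpace V]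
    (v : V) (n : ℕ) : MeasurableSet {X : ℕ → V | ∀ m ≤ n, X m ≠ v} := by
  simp only [Set.ofPred_forall]
  refine MeasurableSet.iInter fun m => MeasurableSet.iInter fun _ => ?_
  have hm : Measurable fun X : ℕ → V => X m := measurable_pi_apply m
  exact hm (MeasurableSet.of_discrete (s := {v}ᶜ))

/-- The series counts the times up to which `v` is still unvisited, so it is the hitting time of
`v`, and covering includes hitting `v`. -/
theorem tsum_avoid_le_coverTimeOf {V : Type*} (v : V) (X : ℕ → V) :
    ∑' n : ℕ, {X : ℕ → V | ∀ m ≤ n, X m ≠ v}.indicator (fun _ => (1 : ℝ≥0∞)) X ≤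
      coverTimeOf X := by
  refine le_iInf₂ fun n hn => ?_
  obtain ⟨m, hm, hX⟩ := hn v
  rw [tsum_eq_sum (s := Finset.range m)]
  · calc _ ≤ ∑ _ ∈ Finset.range m, (1 : ℝ≥0∞) :=
          Finset.sum_le_sum fun i _ => Set.indicator_le_self' (fun _ _ => zero_le) X
      _ = (m : ℝ≥0∞) := by simp
      _ ≤ n := by exact_mod_cast hm
  · intro i hi
    have h : X ∉ {X : ℕ → V | ∀ m ≤ i, X m ≠ v} := fun h => h m (by simpa using hi) hX
    exact Set.indicator_of_notMem h _

variable {V : Type*} [Finite V] [MeasurableSpace V] [DiscreteMeasurableSpace V]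

instance (G : SimpleGraph V) (x : V) : IsProbabilityMeasure (srwLaw G x) := by
  unfold srwLaw; infer_instance

theorem srwLaw_apply_zero (G : SimpleGraph V) (x : V) (ψ : V → ℝ≥0∞) :
    ∫⁻ X, ψ (X 0) ∂(srwLaw G x) = ψ x := by
  have h : (srwLaw G x).map (Preorder.frestrictLe (π := fun _ => V) 0) =
      (Measure.dirac x).map (MeasurableEquiv.piUnique ((fun i : Finset.Iic 0 => V))).symm := by
    rw [srwLaw, Kernel.trajMeasure, Measure.map_comp _ _ (by fun_prop), Kernel.traj_map_frestrictLe,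
      Kernel.partialTraj_self, Measure.id_comp]
  have h1 : ∫⁻ X, ψ (X 0) ∂(srwLaw G x) = ∫⁻ h, ψ (h ⟨0, Finset.mem_Iic.2 le_rfl⟩)
      ∂((srwLaw G x).map (Preorder.frestrictLe (π := fun _ => V) 0)) := by
    rw [lintegral_map Measurable.of_discrete (by fun_prop)]
    rfl
  rw [h1, h, lintegral_map Measurable.of_discrete (by fun_prop), lintegral_dirac]
  rfl

/-- The Markov property at time `n`, on the event that `v` has not been visited. -/
theorem srwLaw_markov (G : SimpleGraph V) (x v : V) (ψ : V → ℝ≥0∞) (n : ℕ) :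
    ∫⁻ X, {X : ℕ → V | ∀ m ≤ n, X m ≠ v}.indicator (fun X => ψ (X (n + 1))) X ∂(srwLaw G x) =
    ∫⁻ X, {X : ℕ → V | ∀ m ≤ n, X m ≠ v}.indicator
      (fun X => ∫⁻ y, ψ y ∂(srwStep G (X n)).toMeasure) X ∂(srwLaw G x) := by
  classical
  have key := Kernel.map_frestrictLe_trajMeasure_compProd_eq_map_trajMeasure
    (X := fun _ => V) (μ₀ := Measure.dirac x) (κ := srwKernel G) (a := n)
  set B : Set (((i : Finset.Iic n) → V) × V) := {p | ∀ i, p.1 i ≠ v}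
  have h1 : ∫⁻ X, {X : ℕ → V | ∀ m ≤ n, X m ≠ v}.indicator (fun X => ψ (X (n + 1))) X
      ∂(srwLaw G x) = ∫⁻ p, B.indicator (fun p => ψ p.2) p ∂((srwLaw G x).map
        (fun X => (Preorder.frestrictLe (π := fun _ => V) n X, X (n + 1)))) := by
    rw [lintegral_map Measurable.of_discrete (by fun_prop)]
    refine lintegral_congr fun X => ?_
    simp only [Set.indicator_apply, B, Set.mem_ofPred_eq, Subtype.forall, Finset.mem_Iic]
    rfl
  rw [h1, srwLaw, ← key, Measure.lintegral_compProd Measurable.of_discrete,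
    lintegral_map Measurable.of_discrete (by fun_prop)]
  refine lintegral_congr fun X => ?_
  simp only [Set.indicator_apply, B, Set.mem_ofPred_eq, Subtype.forall, Finset.mem_Iic]
  change ∫⁻ b, (if ∀ m, m ≤ n → X m ≠ v then ψ b else 0) ∂(srwStep G (X n)).toMeasure = _
  split_ifs <;> simp

/-- A function which vanishes at `v` and is subharmonic up to an error `1` off `v` is a lower bound
for the expected time to hit `v`, hence for the expected cover time. -/
theorem le_lintegral_coverTimeOf (G : SimpleGraph V) (v : V) (ψ : V → ℝ≥0∞)
    (hfin : ∀ x, ψ x ≠ ∞) (hv : ψ v = 0)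
    (hψ : ∀ x, x ≠ v → ψ x ≤ 1 + ∫⁻ y, ψ y ∂(srwStep G x).toMeasure) (x : V) :
    ψ x ≤ ∫⁻ X, coverTimeOf X ∂(srwLaw G x) := by
  classical
  set A : ℕ → Set (ℕ → V) := fun n => {X | ∀ m ≤ n, X m ≠ v} with hA
  have hAm : ∀ n, MeasurableSet (A n) := measurableSet_avoid v
  -- `e n` is the expectation of `ψ (X n)` on the event that `v` has not been hit by time `n`. One
  -- step of the walk lowers it by at most the probability of that event; these probabilities sum to
  -- the expected hitting time.
  set e : ℕ → ℝ≥0∞ := fun n => ∫⁻ X, (A n).indicator (fun X => ψ (X n)) X ∂(srwLaw G x) with he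
  have hψm : Measurable ψ := Measurable.of_discrete
  have h0 : e 0 = ψ x := by
    rw [← srwLaw_apply_zero G x ψ]
    refine lintegral_congr fun X => ?_
    simp only [Set.indicator_apply, hA, Set.mem_ofPred_eq, Nat.le_zero, forall_eq]
    split_ifs with h
    · rfl
    · rw [not_not.1 h, hv]
  have hstep : ∀ n, e n ≤ srwLaw G x (A n) + e (n + 1) := by
    intro n
    -- Because `ψ v = 0`, dropping the condition at time `n + 1` does not change the integrand.
    have h1 : e (n + 1) = ∫⁻ X, (A n).indicator (fun X => ψ (X (n + 1))) X ∂(srwLaw G x) := by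
      refine lintegral_congr fun X => ?_
      simp only [Set.indicator_apply, hA, Set.mem_ofPred_eq]
      by_cases h : X (n + 1) = v
      · simp [h, hv]
      · congr 1
        refine propext ⟨fun h' m hm => h' m (by omega), fun h' m hm => ?_⟩
        rcases Nat.le_succ_iff.1 hm with hm | rfl
        · exact h' m hm
        · exact h
    rw [h1, srwLaw_markov, ← lintegral_indicator_one (hAm n), ← lintegral_add_left]
    · refine lintegral_mono fun X => ?_
      simp only [Set.indicator_apply, Pi.one_apply]
      split_ifs with h
      · exact hψ _ (h n le_rfl)
      · simp
    · exact measurable_one.indicator (hAm n)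
  have hsum : ∀ n, ψ x ≤ ∑ k ∈ Finset.range n, srwLaw G x (A k) + e n := by
    intro n
    induction n with
    | zero => simp [h0]
    | succ n ih =>
      rw [Finset.sum_range_succ, add_assoc]
      exact ih.trans (by gcongr; exact hstep n)
  have hle : ∑' k, srwLaw G x (A k) ≤ ∫⁻ X, coverTimeOf X ∂(srwLaw G x) := by
    calc ∑' k, srwLaw G x (A k) = ∑' k, ∫⁻ X, (A k).indicator (fun _ => 1) X ∂(srwLaw G x) := by
          refine tsum_congr fun k => ?_
          rw [← lintegral_indicator_one (hAm k)]; rfl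
      _ = ∫⁻ X, ∑' k, (A k).indicator (fun _ => 1) X ∂(srwLaw G x) := by
          rw [lintegral_tsum]
          exact fun k => (measurable_const.indicator (hAm k)).aemeasurable
      _ ≤ _ := lintegral_mono fun X => tsum_avoid_le_coverTimeOf v X
  refine le_trans ?_ hle
  by_cases htop : ∑' k, srwLaw G x (A k) = ∞
  · rw [htop]; exact le_top
  have hbd : ∃ C : ℝ≥0∞, C ≠ ∞ ∧ ∀ y, ψ y ≤ C := by
    cases nonempty_fintype V
    exact ⟨∑ y, ψ y, ENNReal.sum_ne_top.2 fun y _ => hfin y,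
      fun y => Finset.single_le_sum (f := ψ) (fun _ _ => zero_le) (Finset.mem_univ y)⟩
  obtain ⟨C, hC, hCψ⟩ := hbd
  -- The remainder tends to `0`: `ψ` is bounded on the finite graph, and the terms of a convergent
  -- series vanish in the limit.
  have hen : ∀ n, e n ≤ C * srwLaw G x (A n) := by
    intro n
    rw [← lintegral_indicator_const (hAm n)]
    refine lintegral_mono fun X => ?_
    simp only [Set.indicator_apply]
    split_ifs
    · exact hCψ _
    · exact le_rfl
  have hlim : Tendsto (fun n => ∑' k, srwLaw G x (A k) + C * srwLaw G x (A n)) atTop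
      (𝓝 (∑' k, srwLaw G x (A k) + C * 0)) :=
    tendsto_const_nhds.add (ENNReal.Tendsto.const_mul
      (ENNReal.tendsto_atTop_zero_of_tsum_ne_top htop) (Or.inr hC))
  rw [mul_zero, add_zero] at hlim
  refine ge_of_tendsto' hlim fun n => (hsum n).trans ?_
  gcongr
  · exact ENNReal.sum_le_tsum _
  · exact hen n

/-- The real form of `le_lintegral_coverTimeOf`. -/
theorem ofReal_le_coverTime (G : SimpleGraph V) (v : V) (φ : V → ℝ) (hv : φ v ≤ 0)
    (hφ : ∀ x, x ≠ v → ∃ s : Finset V, s.Nonempty ∧ (∀ y, y ∈ s ↔ G.Adj x y) ∧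
      ∑ y ∈ s, (φ x - φ y) ≤ s.card) (x : V) :
    ENNReal.ofReal (φ x) ≤ coverTime G := by
  refine le_trans ?_ (le_iSup (fun x => ∫⁻ X, coverTimeOf X ∂(srwLaw G x)) x)
  refine le_lintegral_coverTimeOf G v (fun x => ENNReal.ofReal (φ x))
    (fun _ => ENNReal.ofReal_ne_top) (ENNReal.ofReal_of_nonpos hv) (fun x hx => ?_) x
  obtain ⟨s, hs, hadj, hsum⟩ := hφ x hx
  have hset : (G.neighborSet x).toFinite.toFinset = s := by
    ext y; simp [hadj]
  have hcard : (0 : ℝ) < s.card := by exact_mod_cast hs.card_pos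
  have hstep : ∫⁻ y, ENNReal.ofReal (φ y) ∂(srwStep G x).toMeasure =
      ∑ y ∈ s, ENNReal.ofReal (φ y) * (s.card : ℝ≥0∞)⁻¹ := by
    have h1 : srwStep G x = PMF.uniformOfFinset s hs := by
      unfold srwStep
      subst hset
      rw [dif_pos hs]
    rw [h1, lintegral_countable' , tsum_eq_sum (s := s)]
    · refine Finset.sum_congr rfl fun y hy => ?_
      rw [PMF.toMeasure_apply_singleton _ _ MeasurableSet.of_discrete,
        PMF.uniformOfFinset_apply_of_mem hs hy]
    · intro y hy
      rw [PMF.toMeasure_apply_singleton _ _ MeasurableSet.of_discrete,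
        PMF.uniformOfFinset_apply_of_notMem hs hy, mul_zero]
  rw [hstep, ← Finset.sum_mul]
  have h2 : φ x ≤ 1 + (∑ y ∈ s, φ y) * (s.card : ℝ)⁻¹ := by
    rw [Finset.sum_sub_distrib, Finset.sum_const, nsmul_eq_mul] at hsum
    rw [← sub_nonneg]
    have : 1 + (∑ y ∈ s, φ y) * (s.card : ℝ)⁻¹ - φ x =
        (s.card - (s.card * φ x - ∑ y ∈ s, φ y)) * (s.card : ℝ)⁻¹ := by
      field_simp
      ring
    rw [this]
    exact mul_nonneg (by linarith) (by positivity)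
  -- Truncating `φ` at `0` preserves the inequality, since the positive part is subadditive.
  calc ENNReal.ofReal (φ x) ≤ ENNReal.ofReal (1 + (∑ y ∈ s, φ y) * (s.card : ℝ)⁻¹) :=
        ENNReal.ofReal_le_ofReal h2
    _ ≤ 1 + ENNReal.ofReal ((∑ y ∈ s, φ y) * (s.card : ℝ)⁻¹) := by
        refine ENNReal.ofReal_add_le.trans ?_
        rw [ENNReal.ofReal_one]
    _ ≤ _ := by
        gcongr
        rw [ENNReal.ofReal_mul' (by positivity), ENNReal.ofReal_inv_of_pos hcard,
          ENNReal.ofReal_natCast]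
        gcongr
        exact Finset.le_sum_of_subadditive _ ENNReal.ofReal_zero.le
          (fun _ _ => ENNReal.ofReal_add_le) _ _

end RandomWalk

/-! ## A lower bound for the cover time of a tree -/

/-- The function on labels with increment `w y` along the edge from the parent of `y` to `y`. -/
def potential (w : List ℕ → ℝ) : List ℕ → ℝ
  | [] => 0
  | j :: u => potential w u + w (j :: u)

theorem potential_sub_smul (w w' : List ℕ → ℝ) (κ : ℝ) (u : List ℕ) :
    potential (fun y => w y - κ * w' y) u = potential w u - κ * potential w' u := by
  induction u with
  | nil => simp [potential]
  | cons j u ih => simp only [potential, ih]; ring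

open Classical in
-- Labels carry the latest rank first, so the ancestors of `v` are its suffixes and every edge
-- between the root and `u` lies on the path to `v`.
theorem potential_suffix_indicator (v u : List ℕ) (h : u <:+ v) :
    potential (fun y => if y <:+ v then 1 else 0) u = u.length := by
  induction u with
  | nil => simp [potential]
  | cons j u ih =>
    simp [potential, h, ih ((List.suffix_cons j u).trans h)]

namespace FamilyTree

/-- The vertices of the first `N` generations, as a finset. -/
noncomputable def upToFinset (t : FamilyTree) (N : ℕ) : Finset (List ℕ) :=
  (t.finite_upTo N).toFinset

theorem mem_upToFinset {t : FamilyTree} {N : ℕ} {u : List ℕ} :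
    u ∈ t.upToFinset N ↔ u ∈ t.verts ∧ u.length ≤ N := by
  rw [upToFinset, Set.Finite.mem_toFinset]; rfl

theorem mem_of_suffix (t : FamilyTree) : ∀ {u v : List ℕ}, u <:+ v → v ∈ t.verts → u ∈ t.verts
  | u, [], h, hv => by rwa [List.suffix_nil.1 h]
  | u, j :: v, h, hv => by
    rcases List.suffix_cons_iff.1 h with rfl | h
    · exact hv
    · exact t.mem_of_suffix h (t.parent_mem _ _ hv)

open Classical in
/-- The children of `x` within the first `N` generations. -/
noncomputable def childrenUpTo (t : FamilyTree) (N : ℕ) (x : List ℕ) : Finset (List ℕ) :=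
  (t.upToFinset N).filter fun y => ∃ i, y = i :: x

open Classical in
/-- The number of descendants of `y` (including `y`) within the first `N` generations. -/
noncomputable def descendants (t : FamilyTree) (N : ℕ) (y : List ℕ) : Finset (List ℕ) :=
  (t.upToFinset N).filter fun z => y <:+ z

theorem suffix_unique {i j : ℕ} {x z : List ℕ} (hi : i :: x <:+ z) (hj : j :: x <:+ z) :
    i = j := by
  have h := List.suffix_of_suffix_length_le hi hj (by simp)
  have h' := h.eq_of_length (by simp)
  simpa using h'

theorem exists_cons_suffix {x z : List ℕ} (h : x <:+ z) (hne : x ≠ z) : ∃ i, i :: x <:+ z := by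
  obtain ⟨a, rfl⟩ := h
  rcases List.eq_nil_or_concat a with rfl | ⟨b, i, rfl⟩
  · simp at hne
  · exact ⟨i, b, by simp⟩

/-- A descendant other than `x` itself lies below exactly one child of `x`. -/
theorem sum_card_descendants (t : FamilyTree) (N : ℕ) {x : List ℕ} (hx : x ∈ t.upToFinset N) :
    ∑ y ∈ t.childrenUpTo N x, ((t.descendants N y).card : ℝ) = (t.descendants N x).card - 1 := by
  classical
  have h : t.descendants N x =
      insert x ((t.childrenUpTo N x).biUnion fun y => t.descendants N y) := by
    ext z
    simp only [descendants, childrenUpTo, Finset.mem_filter, Finset.mem_insert, Finset.mem_biUnion]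
    constructor
    · rintro ⟨hz, hs⟩
      by_cases hne : x = z
      · exact Or.inl hne.symm
      · obtain ⟨i, hi⟩ := exists_cons_suffix hs hne
        rw [mem_upToFinset] at hz
        exact Or.inr ⟨i :: x, ⟨mem_upToFinset.2 ⟨t.mem_of_suffix hi hz.1,
          hi.length_le.trans hz.2⟩, i, rfl⟩, mem_upToFinset.2 hz, hi⟩
    · rintro (rfl | ⟨_, ⟨_, i, rfl⟩, hz, hs⟩)
      · exact ⟨hx, List.suffix_rfl⟩
      · exact ⟨hz, (List.suffix_cons i x).trans hs⟩
  rw [h, Finset.card_insert_of_notMem, Finset.card_biUnion]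
  · push_cast; ring
  · intro y hy y' hy' hne
    simp only [childrenUpTo, Finset.coe_filter, Set.mem_ofPred_eq] at hy hy'
    obtain ⟨_, i, rfl⟩ := hy
    obtain ⟨_, j, rfl⟩ := hy'
    refine Finset.disjoint_left.2 fun z hz hz' => hne ?_
    simp only [descendants, Finset.mem_filter] at hz hz'
    rw [suffix_unique hz.2 hz'.2]
  · simp only [descendants, childrenUpTo, Finset.mem_filter, Finset.mem_biUnion, not_exists]
    rintro _ ⟨⟨_, i, rfl⟩, _, hs⟩
    simpa using hs.length_le

open Classical in
-- Conservation of the unit flow from the root to `v`: away from `v`, what enters `x` from its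
-- parent leaves through one child.
theorem sum_suffix_children (t : FamilyTree) (N : ℕ) {x v : List ℕ} (hv : v ∈ t.upToFinset N)
    (hne : x ≠ v) :
    ∑ y ∈ t.childrenUpTo N x, (if y <:+ v then (1 : ℝ) else 0) = if x <:+ v then 1 else 0 := by
  split_ifs with h
  · obtain ⟨i, hi⟩ := exists_cons_suffix h hne
    rw [Finset.sum_eq_single (i :: x), if_pos hi]
    · intro y hy hyi
      simp only [childrenUpTo, Finset.mem_filter] at hy
      obtain ⟨_, j, rfl⟩ := hy
      exact if_neg fun hj => hyi (by rw [suffix_unique hi hj])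
    · intro hn
      rw [mem_upToFinset] at hv
      exact absurd (Finset.mem_filter.2 ⟨mem_upToFinset.2 ⟨t.mem_of_suffix hi hv.1,
        hi.length_le.trans hv.2⟩, i, rfl⟩) hn
  · refine Finset.sum_eq_zero fun y hy => if_neg fun hs => h ?_
    simp only [childrenUpTo, Finset.mem_filter] at hy
    obtain ⟨_, j, rfl⟩ := hy
    exact (List.suffix_cons j x).trans hs

/-- The neighbours of `x` in the first `N` generations. -/
noncomputable def neighborsUpTo (t : FamilyTree) (N : ℕ) : List ℕ → Finset (List ℕ)
  | [] => t.childrenUpTo N []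
  | j :: u => insert u (t.childrenUpTo N (j :: u))

theorem mem_neighborsUpTo {t : FamilyTree} {N : ℕ} {x : List ℕ} (hx : x ∈ t.upTo N) (y : List ℕ) :
    y ∈ t.neighborsUpTo N x ↔ y ∈ t.upTo N ∧ ((∃ i, y = i :: x) ∨ ∃ i, x = i :: y) := by
  have hm : ∀ z, z ∈ t.upToFinset N ↔ z ∈ t.upTo N := fun z => Set.Finite.mem_toFinset _
  cases x with
  | nil => simp [neighborsUpTo, childrenUpTo, hm]
  | cons j u =>
    simp only [neighborsUpTo, childrenUpTo, Finset.mem_insert, Finset.mem_filter, hm,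
      List.cons.injEq]
    constructor
    · rintro (rfl | ⟨h1, h2⟩)
      · exact ⟨⟨t.parent_mem _ _ hx.1, (by simp : y.length ≤ (j :: y).length).trans hx.2⟩,
          Or.inr ⟨j, rfl, rfl⟩⟩
      · exact ⟨h1, Or.inl h2⟩
    · rintro ⟨h1, h2 | ⟨_, _, rfl⟩⟩
      · exact Or.inr ⟨h1, h2⟩
      · exact Or.inl rfl

theorem sum_neighbors_nil (t : FamilyTree) (N : ℕ) (w : List ℕ → ℝ) :
    ∑ y ∈ t.neighborsUpTo N [], (potential w [] - potential w y) =
      -∑ y ∈ t.childrenUpTo N [], w y := by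
  rw [neighborsUpTo, ← Finset.sum_neg_distrib]
  refine Finset.sum_congr rfl fun y hy => ?_
  simp only [childrenUpTo, Finset.mem_filter] at hy
  obtain ⟨_, j, rfl⟩ := hy
  simp [potential]

theorem notMem_childrenUpTo_cons (t : FamilyTree) (N : ℕ) (j : ℕ) (u : List ℕ) :
    u ∉ t.childrenUpTo N (j :: u) := by
  simp only [childrenUpTo, Finset.mem_filter, not_and, not_exists]
  intro _ i h
  have := congrArg List.length h
  simp only [List.length_cons] at this
  omega

/-- The Laplacian of a potential is a divergence: the increment on the edge to the parent minus
those on the edges to the children. At the root the first term is missing. -/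
theorem sum_neighbors_cons (t : FamilyTree) (N : ℕ) (w : List ℕ → ℝ) (j : ℕ) (u : List ℕ) :
    ∑ y ∈ t.neighborsUpTo N (j :: u), (potential w (j :: u) - potential w y) =
      w (j :: u) - ∑ y ∈ t.childrenUpTo N (j :: u), w y := by
  classical
  rw [neighborsUpTo, Finset.sum_insert (t.notMem_childrenUpTo_cons N j u), sub_eq_add_neg (w _),
    ← Finset.sum_neg_distrib]
  congr 1
  · simp [potential]
  · refine Finset.sum_congr rfl fun y hy => ?_
    simp only [childrenUpTo, Finset.mem_filter] at hy
    obtain ⟨_, i, rfl⟩ := hy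
    simp [potential]

/-- Carries the subharmonicity criterion over to labels, where it can be checked edge by edge; the
potential is shifted to vanish at the target `v`. Only the root could lack a neighbour, which
`hroot` excludes. -/
theorem ofReal_potential_le_coverTime (t : FamilyTree) (N : ℕ) {v : List ℕ} (hv : v ∈ t.upTo N)
    (hroot : (t.childrenUpTo N []).Nonempty) (w : List ℕ → ℝ)
    (hw : ∀ x ∈ t.upTo N, x ≠ v →
      ∑ y ∈ t.neighborsUpTo N x, (potential w x - potential w y) ≤ (t.neighborsUpTo N x).card)
    {x : List ℕ} (hx : x ∈ t.upTo N) :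
    ENNReal.ofReal (potential w x - potential w v) ≤ coverTime (t.graphUpTo N) := by
  classical
  refine ofReal_le_coverTime (t.graphUpTo N) (⟨v, hv⟩ : t.UpTo N)
    (fun y => potential w y.1 - potential w v) (by simp) (fun x hxv => ?_) (⟨x, hx⟩ : t.UpTo N)
  have hmem := mem_neighborsUpTo (t := t) (N := N) x.2
  cases nonempty_fintype (t.UpTo N)
  set s : Finset (t.UpTo N) := Finset.univ.filter fun y => (t.graphUpTo N).Adj x y with hs
  have himage : s.image (fun y : t.UpTo N => y.1) = t.neighborsUpTo N x.1 := by
    ext y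
    rw [hmem, Finset.mem_image]
    constructor
    · rintro ⟨y, hy, rfl⟩
      exact ⟨y.2, (Finset.mem_filter.1 hy).2⟩
    · rintro ⟨hy, hadj⟩
      exact ⟨⟨y, hy⟩, Finset.mem_filter.2 ⟨Finset.mem_univ _, hadj⟩, rfl⟩
  have hinj : Function.Injective (fun y : t.UpTo N => y.1) := Subtype.val_injective
  refine ⟨s, ?_, fun y => ?_, ?_⟩
  · have : (t.neighborsUpTo N x.1).Nonempty := by
      cases h : x.1 with
      | nil => exact hroot
      | cons j u => exact ⟨u, Finset.mem_insert_self _ _⟩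
    rwa [← himage, Finset.image_nonempty] at this
  · rw [hs, Finset.mem_filter]
    simp
  · have h := hw x.1 x.2 fun h => hxv (Subtype.ext h)
    rw [← himage, Finset.sum_image hinj.injOn, Finset.card_image_of_injective _ hinj] at h
    refine le_trans (le_of_eq ?_) h
    refine Finset.sum_congr rfl fun y _ => ?_
    ring

/-- The cover time of the first `N` generations is at least the number of edges times `N`. -/
theorem ofReal_edges_mul_le_coverTime (t : FamilyTree) (N : ℕ) (hN : (t.level N).Nonempty) :
    ENNReal.ofReal ((((t.upTo N).ncard : ℝ) - 1) * N) ≤ coverTime (t.graphUpTo N) := by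
  classical
  rcases Nat.eq_zero_or_pos N with rfl | hpos
  · simp
  obtain ⟨v, hvt, hvl⟩ := hN
  have hv : v ∈ t.upTo N := ⟨hvt, hvl.le⟩
  have hvne : v ≠ [] := by rintro rfl; simp at hvl; omega
  have hvf : v ∈ t.upToFinset N := mem_upToFinset.2 hv
  have hnil : [] ∈ t.upTo N := ⟨t.root_mem, by simp⟩
  have hroot : (t.childrenUpTo N []).Nonempty := by
    obtain ⟨i, hi⟩ := exists_cons_suffix (List.nil_suffix (l := v)) hvne.symm
    exact ⟨[i], Finset.mem_filter.2 ⟨mem_upToFinset.2 ⟨t.mem_of_suffix hi hvt,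
      hi.length_le.trans hvl.le⟩, i, rfl⟩⟩
  -- `w y` is the expected time to pass from `y` to its parent, and `κ - w y` is the expected time
  -- for the reverse crossing, where `κ` is twice the number of edges. Subtracting `κ` along the
  -- path to `v` therefore turns the potential for hitting the root into the one for hitting `v`.
  set w : List ℕ → ℝ := fun y => 2 * (t.descendants N y).card - 1 with hw
  set w' : List ℕ → ℝ := fun y => if y <:+ v then 1 else 0 with hw'
  set κ : ℝ := 2 * ((t.upTo N).ncard - 1) with hκ
  have hsumw : ∀ x ∈ t.upTo N, ∑ y ∈ t.childrenUpTo N x, w y =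
      2 * ((t.descendants N x).card - 1) - (t.childrenUpTo N x).card := by
    intro x hx
    rw [← t.sum_card_descendants N (mem_upToFinset.2 hx), hw, Finset.sum_sub_distrib,
      ← Finset.mul_sum]
    simp
  have hcardcons : ∀ j u, ((t.neighborsUpTo N (j :: u)).card : ℝ) =
      (t.childrenUpTo N (j :: u)).card + 1 := by
    intro j u
    rw [neighborsUpTo, Finset.card_insert_of_notMem (t.notMem_childrenUpTo_cons N j u)]
    push_cast; ring
  have h1 : ENNReal.ofReal (potential w v) ≤ coverTime (t.graphUpTo N) := by
    have := t.ofReal_potential_le_coverTime N hnil hroot w (fun x hx hxne => ?_) hv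
    · simpa [potential] using this
    cases x with
    | nil => exact absurd rfl hxne
    | cons j u =>
      rw [sum_neighbors_cons, hsumw _ hx, hcardcons, hw]
      linarith
  have hdesc : ((t.descendants N []).card : ℝ) = (t.upTo N).ncard := by
    rw [Set.ncard_eq_toFinset_card _ (t.finite_upTo N), descendants, upToFinset,
      Finset.filter_true_of_mem fun _ _ => List.nil_suffix]
  have h2 : ENNReal.ofReal (κ * N - potential w v) ≤ coverTime (t.graphUpTo N) := by
    have := t.ofReal_potential_le_coverTime N hv hroot (fun y => w y - κ * w' y)
      (fun x hx hxne => ?_) hnil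
    · rw [potential_sub_smul, potential_sub_smul, hw', potential_suffix_indicator v v List.suffix_rfl,
        hvl] at this
      simpa [potential] using this
    cases x with
    | nil =>
      rw [sum_neighbors_nil, Finset.sum_sub_distrib, ← Finset.mul_sum, hsumw _ hx,
        t.sum_suffix_children N hvf hvne.symm, if_pos List.nil_suffix, neighborsUpTo, hdesc, hκ]
      linarith
    | cons j u =>
      rw [sum_neighbors_cons, Finset.sum_sub_distrib, ← Finset.mul_sum, hsumw _ hx,
        t.sum_suffix_children N hvf hxne, hcardcons]
      simp only [hw, hw']
      linarith
  -- The two hitting times sum to `κ * N`, so one of them is at least half of it.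
  rcases le_total (κ * N / 2) (potential w v) with h | h
  · refine le_trans (ENNReal.ofReal_le_ofReal ?_) h1
    rw [hκ] at h; linarith
  · refine le_trans (ENNReal.ofReal_le_ofReal ?_) h2
    rw [hκ] at h ⊢; linarith

end FamilyTree

/-! ## Convolution powers -/

section ConvPow

variable {E : Type*} [AddCommMonoid E] [MeasurableSpace E]

/-- The law of the sum of `n` independent variables with law `μ`. -/
noncomputable def convPow (μ : Measure E) : ℕ → Measure E
  | 0 => Measure.dirac 0
  | n + 1 => μ.conv (convPow μ n)

variable [MeasurableAdd₂ E]

instance (μ : Measure E) [IsProbabilityMeasure μ] (n : ℕ) : IsProbabilityMeasure (convPow μ n) := by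
  induction n with
  | zero => unfold convPow; infer_instance
  | succ n ih => unfold convPow; infer_instance

theorem convPow_add (μ : Measure E) [IsProbabilityMeasure μ] (m n : ℕ) :
    convPow μ (m + n) = (convPow μ m).conv (convPow μ n) := by
  induction m with
  | zero => simp [convPow]
  | succ m ih => rw [Nat.succ_add, convPow, convPow, ih, Measure.conv_assoc]

theorem conv_apply_ge (μ ρ : Measure E) [SFinite μ] [SFinite ρ] {A B C : Set E}
    (hC : MeasurableSet C) (h : ∀ x ∈ A, ∀ y ∈ B, x + y ∈ C) : μ A * ρ B ≤ μ.conv ρ C := by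
  rw [Measure.conv, Measure.map_apply (by fun_prop) hC, ← Measure.prod_prod]
  exact measure_mono fun p hp => h _ hp.1 _ hp.2

theorem conv_apply_le (μ ρ : Measure E) [SFinite μ] [SFinite ρ] {A B C : Set E}
    (hC : MeasurableSet C) (h : ∀ x y, x + y ∈ C → x ∈ A ∧ y ∈ B) : μ.conv ρ C ≤ μ A * ρ B := by
  rw [Measure.conv, Measure.map_apply (by fun_prop) hC, ← Measure.prod_prod]
  exact measure_mono fun p hp => h _ _ hp

/-- A sum in `A` forces all of its independent summands into `A`. This is applied to complements of
increasing events. -/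
theorem convPow_apply_le_pow (μ : Measure E) [IsProbabilityMeasure μ] {A : Set E}
    (hA : MeasurableSet A) (h : ∀ x y, x + y ∈ A → x ∈ A ∧ y ∈ A) (n : ℕ) :
    convPow μ n A ≤ μ A ^ n := by
  induction n with
  | zero => simpa using prob_le_one
  | succ n ih =>
    rw [convPow, pow_succ']
    exact (conv_apply_le μ _ hA h).trans (by gcongr)

theorem convPow_apply_eq_pow (μ : Measure E) [IsProbabilityMeasure μ] {A : Set E}
    (hA : MeasurableSet A) (h0 : 0 ∈ A) (h : ∀ x y, x + y ∈ A ↔ x ∈ A ∧ y ∈ A) (n : ℕ) :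
    convPow μ n A = μ A ^ n := by
  induction n with
  | zero => simp [convPow, hA, h0]
  | succ n ih =>
    rw [convPow, pow_succ', ← ih]
    exact le_antisymm (conv_apply_le μ _ hA fun x y => (h x y).1)
      (conv_apply_ge μ _ hA fun x hx y hy => (h x y).2 ⟨hx, hy⟩)

theorem map_sum_eq_convPow {ι Ω : Type*} [MeasurableSpace Ω] {P : Measure Ω} {μ : Measure E}
    [IsProbabilityMeasure P] [IsProbabilityMeasure μ] {X : ι → Ω → E} (hX : ∀ i, Measurable (X i))
    (hind : iIndepFun X P) (hlaw : ∀ i, P.map (X i) = μ) (s : Finset ι) :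
    P.map (fun ω => ∑ i ∈ s, X i ω) = convPow μ s.card := by
  classical
  induction s using Finset.induction_on with
  | empty =>
    simp [convPow]
  | insert i s hi ih =>
    have h := (hind.indepFun_finsetSum_of_notMem hX hi).symm
    have hsum : ∑ j ∈ s, X j = fun ω => ∑ j ∈ s, X j ω := funext fun ω => Finset.sum_apply _ _ _
    rw [hsum] at h
    simp only [Finset.sum_insert hi]
    rw [Finset.card_insert_of_notMem hi, convPow, ← ih, ← hlaw i]
    exact h.map_add_eq_map_conv_map (hX i) (Finset.measurable_sum s fun i _ => hX i)

end ConvPow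

/-! ## The branching property -/

namespace FamilyTree

/-- The generation sizes. -/
noncomputable def genSize (t : FamilyTree) (k : ℕ) : ℕ := (t.level k).ncard

/-- The number of vertices of generation `k` in a finite set of labels. -/
def countLength (k : ℕ) (s : Finset (List ℕ)) : ℕ := (s.filter fun u => u.length = k).card

theorem genSize_eq_countLength (t : FamilyTree) {j k : ℕ} (h : j ≤ k) :
    t.genSize j = countLength j (t.upToFinset k) := by
  rw [genSize, countLength, ← Set.ncard_coe_finset]
  congr 1
  ext u
  simp only [level, Set.mem_ofPred_eq, Finset.coe_filter, mem_upToFinset]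
  constructor
  · rintro ⟨h1, h2⟩; exact ⟨⟨h1, by omega⟩, h2⟩
  · rintro ⟨⟨h1, _⟩, h2⟩; exact ⟨h1, h2⟩

theorem upToFinset_eq_iff (t : FamilyTree) (k : ℕ) (s : Finset (List ℕ)) :
    t.upToFinset k = s ↔ t.upTo k = s := by
  rw [upToFinset, ← Finset.coe_inj, Set.Finite.coe_toFinset]

theorem upToFinset_eq_upToFinset_iff (t S : FamilyTree) (k : ℕ) :
    t.upToFinset k = S.upToFinset k ↔ t.upTo k = S.upTo k := by
  rw [upToFinset, upToFinset, Set.Finite.toFinset_inj]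

theorem measurableSet_upToFinset_eq (k : ℕ) (s : Finset (List ℕ)) :
    MeasurableSet {t : FamilyTree | t.upToFinset k = s} := by
  simp only [upToFinset_eq_iff]
  exact measurableSet_upTo_eq k s

/-- There are only countably many finite sets of labels. Recording a truncated tree as a `Finset`
thus makes every function of it measurable and every integral a series. -/
theorem measurable_upToFinset (k : ℕ) : Measurable[_, ⊤] fun t : FamilyTree => t.upToFinset k := by
  let _ : MeasurableSpace (Finset (List ℕ)) := ⊤
  exact measurable_to_countable' fun s => measurableSet_upToFinset_eq k s

theorem measurable_comp_upToFinset {β : Type*} [MeasurableSpace β] (k : ℕ)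
    (H : Finset (List ℕ) → β) : Measurable fun t : FamilyTree => H (t.upToFinset k) := by
  let _ : MeasurableSpace (Finset (List ℕ)) := ⊤
  exact Measurable.comp (g := H) measurable_from_top (measurable_upToFinset k)

theorem measurable_genSize (k : ℕ) : Measurable fun t : FamilyTree => t.genSize k := by
  simp only [genSize_eq_countLength _ le_rfl]
  exact measurable_comp_upToFinset k _

theorem setLIntegral_upToFinset (P : Measure FamilyTree) (k : ℕ) {A : Set FamilyTree}
    (H : Finset (List ℕ) → ℝ≥0∞) :
    ∫⁻ t in A, H (t.upToFinset k) ∂P = ∑' s, H s * P ({t | t.upToFinset k = s} ∩ A) := by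
  let _ : MeasurableSpace (Finset (List ℕ)) := ⊤
  have hK : Measurable fun t : FamilyTree => t.upToFinset k := measurable_upToFinset k
  rw [← lintegral_map (f := H) measurable_from_top hK, lintegral_countable']
  refine tsum_congr fun s => ?_
  rw [Measure.map_apply hK (measurableSet_singleton s),
    Measure.restrict_apply (hK (measurableSet_singleton s))]
  rfl

theorem measure_eq_tsum_upToFinset (P : Measure FamilyTree) (k : ℕ) (A : Set FamilyTree) :
    P A = ∑' s, P ({t | t.upToFinset k = s} ∩ A) := by
  have := setLIntegral_upToFinset P k (A := A) (fun _ => 1)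
  simpa using this

theorem memOfOffspring_append (f : List ℕ → ℕ) (w v : List ℕ) :
    memOfOffspring f (w ++ v) ↔
      memOfOffspring f v ∧ memOfOffspring (fun u => f (u ++ v)) w := by
  induction w with
  | nil => simp [memOfOffspring]
  | cons i w ih =>
    simp only [List.cons_append, memOfOffspring, ih, and_assoc]

/-- The generation sizes after generation `M` are the sums of those of the subtrees. -/
theorem genSize_add (f : List ℕ → ℕ) (M j : ℕ) :
    (ofOffspring f).genSize (M + j) = ∑ v ∈ ((ofOffspring f).finite_level M).toFinset,
      (ofOffspring fun w => f (w ++ v)).genSize j := by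
  classical
  set L := ((ofOffspring f).finite_level M).toFinset with hL
  have hmemL : ∀ v, v ∈ L ↔ memOfOffspring f v ∧ v.length = M :=
    fun v => Set.Finite.mem_toFinset _
  have hmem : ∀ (f : List ℕ → ℕ) (k : ℕ) (u : List ℕ),
      u ∈ ((ofOffspring f).finite_level k).toFinset ↔ memOfOffspring f u ∧ u.length = k :=
    fun f k u => Set.Finite.mem_toFinset _
  simp only [genSize, Set.ncard_eq_toFinset_card _ (finite_level _ _)]
  -- Each label of generation `M + j` is uniquely `w ++ v`, with `v` its ancestor in generation `M`
  -- and `w` its label in the subtree at `v`.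
  have h : ((ofOffspring f).finite_level (M + j)).toFinset = L.biUnion fun v =>
      (((ofOffspring fun w => f (w ++ v)).finite_level j).toFinset).image fun w => w ++ v := by
    ext u
    simp only [hmem, Finset.mem_biUnion, hmemL, Finset.mem_image]
    constructor
    · rintro ⟨hu, hl⟩
      have hu' := hu
      rw [← List.take_append_drop j u, memOfOffspring_append] at hu'
      exact ⟨u.drop j, ⟨hu'.1, by simp [hl]⟩, u.take j, ⟨hu'.2, by simp [hl]⟩,
        List.take_append_drop j u⟩
    · rintro ⟨v, ⟨hv, hvl⟩, w, ⟨hw, hwl⟩, rfl⟩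
      exact ⟨(memOfOffspring_append f w v).2 ⟨hv, hw⟩, by simp [hvl, hwl, add_comm]⟩
  rw [h, Finset.card_biUnion]
  · refine Finset.sum_congr rfl fun v _ => ?_
    exact Finset.card_image_of_injective _ (List.append_left_injective v)
  · intro v hv v' hv' hne
    refine Finset.disjoint_left.2 fun u hu hu' => hne ?_
    simp only [Finset.mem_image] at hu hu'
    obtain ⟨w, _, rfl⟩ := hu
    obtain ⟨w', _, h'⟩ := hu'
    have h1 := ((hmemL v).1 hv).2
    have h2 := ((hmemL v').1 hv').2
    exact (List.append_inj' h' (by omega)).2.symm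

end FamilyTree

/-- The law of the sequence of generation sizes. -/
noncomputable def pathLaw (ν : PMF ℕ) : Measure (ℕ → ℕ) := (gwLaw ν).map genSize

theorem measurable_genSize' : Measurable genSize := measurable_pi_iff.2 measurable_genSize

instance (ν : PMF ℕ) : IsProbabilityMeasure (gwLaw ν) := isProbabilityMeasure_gwLaw ν

instance (ν : PMF ℕ) : IsProbabilityMeasure (pathLaw ν) :=
  Measure.isProbabilityMeasure_map measurable_genSize'.aemeasurable

/-- Splitting of a label into its ancestor of generation `M` and the rest. -/
def splitLabel (M : ℕ) (u : List ℕ) : List ℕ × List ℕ :=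
  (u.drop (u.length - M), u.take (u.length - M))

theorem splitLabel_injective (M : ℕ) : Function.Injective (splitLabel M) := by
  intro u v h
  simp only [splitLabel, Prod.mk.injEq] at h
  rw [← List.take_append_drop (u.length - M) u, h.1, h.2, List.take_append_drop]

theorem splitLabel_append {M : ℕ} {v : List ℕ} (hv : v.length = M) (w : List ℕ) :
    splitLabel M (w ++ v) = (v, w) := by
  subst hv
  simp [splitLabel]

theorem splitLabel_of_length_lt {M : ℕ} {u : List ℕ} (hu : u.length < M) :
    splitLabel M u = (u, []) := by
  simp [splitLabel, Nat.sub_eq_zero_of_le hu.le]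

/-- The numbers of children, given those in the subtrees at the vertices of generation `M`. -/
def glue (M : ℕ) (g : List ℕ → List ℕ → ℕ) (u : List ℕ) : ℕ :=
  g (splitLabel M u).1 (splitLabel M u).2

theorem measurable_glue (M : ℕ) : Measurable (glue M) := by
  refine measurable_pi_iff.2 fun u => ?_
  have h : Measurable fun g : List ℕ → List ℕ → ℕ => g (splitLabel M u).1 :=
    measurable_pi_apply _
  exact (measurable_pi_apply _).comp h

/-- By injectivity of `splitLabel M`, gluing reads distinct coordinates of an i.i.d. array, so the
result is again i.i.d. This realises the tree on a product space where the subtrees at generation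
`M` are separate coordinates. -/
theorem map_glue (ν : PMF ℕ) (M : ℕ) :
    (Measure.infinitePi fun _ : List ℕ => Measure.infinitePi fun _ : List ℕ => ν.toMeasure).map
      (glue M) = Measure.infinitePi fun _ : List ℕ => ν.toMeasure := by
  have h1 := Measure.infinitePi_map_curry_symm (fun _ _ : List ℕ => ν.toMeasure)
  have h2 := Measure.map_infinitePi_infinitePi_of_inj
    (P := fun _ : List ℕ × List ℕ => ν.toMeasure) (splitLabel_injective M)
  rw [← h1, Measure.map_map (by fun_prop) (by fun_prop)] at h2
  exact h2

/-- After gluing, the first `M` generations depend on the coordinates `g u` with `u` shorter than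
`M` (only through `g u []`), and the later ones on the `g v` with `v` in generation `M`. These are
disjoint families of independent coordinates. -/
theorem branching_upTo (ν : PMF ℕ) (M : ℕ) (S : FamilyTree) {F : Set (ℕ → ℕ)}
    (hF : MeasurableSet F) :
    gwLaw ν ({t | t.upTo M = S.upTo M} ∩ {t | (fun j => t.genSize (M + j)) ∈ F}) =
      gwLaw ν {t | t.upTo M = S.upTo M} * convPow (pathLaw ν) (S.genSize M) F := by
  classical
  obtain ⟨c, rfl⟩ := exists_eq_ofOffspring S
  set Q := Measure.infinitePi fun _ : List ℕ => Measure.infinitePi fun _ : List ℕ => ν.toMeasure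
    with hQ
  have hgw : gwLaw ν = Q.map fun g => ofOffspring (glue M g) := by
    rw [gwLaw, ← map_glue ν M, Measure.map_map measurable_ofOffspring (measurable_glue M)]
    rfl
  have hm : Measurable fun g => ofOffspring (glue M g) :=
    measurable_ofOffspring.comp (measurable_glue M)
  set D := innerVerts c M with hD
  set L := ((ofOffspring c).finite_level M).toFinset with hL
  have hmemL : ∀ v, v ∈ L ↔ memOfOffspring c v ∧ v.length = M :=
    fun v => Set.Finite.mem_toFinset _
  have hDL : Disjoint D L := Finset.disjoint_left.2 fun u hu hu' => by
    rw [hD, mem_innerVerts] at hu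
    rw [hmemL] at hu'
    omega
  set X : (List ℕ → ℕ) → ℕ → ℕ := fun f => (ofOffspring f).genSize with hXdef
  have hX : Measurable X := measurable_genSize'.comp measurable_ofOffspring
  have hind : iIndepFun (fun v (g : List ℕ → List ℕ → ℕ) => g v) Q :=
    iIndepFun_infinitePi (X := fun _ f => f) fun _ => measurable_id
  have hlaw : ∀ v, Q.map (fun g => X (g v)) = pathLaw ν := by
    intro v
    have h1 : Q.map (fun g : List ℕ → List ℕ → ℕ => g v) =
        Measure.infinitePi fun _ : List ℕ => ν.toMeasure := Measure.infinitePi_map_eval _ v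
    rw [pathLaw, gwLaw, ← h1, Measure.map_map measurable_genSize' measurable_ofOffspring,
      Measure.map_map (measurable_genSize'.comp measurable_ofOffspring) (measurable_pi_apply v)]
    rfl
  have hsum := map_sum_eq_convPow (X := fun v (g : List ℕ → List ℕ → ℕ) => X (g v))
    (fun v => hX.comp (measurable_pi_apply v)) (hind.comp (fun _ => X) fun _ => hX) hlaw L
  have hcard : L.card = (ofOffspring c).genSize M := by
    rw [genSize, Set.ncard_eq_toFinset_card _ (finite_level _ _)]
  have hA : (fun g => ofOffspring (glue M g)) ⁻¹' {t | t.upTo M = (ofOffspring c).upTo M} =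
      {g | ∀ u ∈ D, g u [] = c u} := by
    ext g
    simp only [Set.mem_preimage, Set.mem_ofPred_eq, upTo_ofOffspring_eq_iff, hD, mem_innerVerts,
      and_imp]
    refine forall₃_congr fun u _ hu => ?_
    rw [glue, splitLabel_of_length_lt hu]
  -- Once the first `M` generations are prescribed, generation `M` is the deterministic set `L`, so
  -- the random sum over subtrees has a fixed index set.
  have hB : {g | ∀ u ∈ D, g u [] = c u} ∩ (fun g => ofOffspring (glue M g)) ⁻¹'
        {t | (fun j => t.genSize (M + j)) ∈ F} =
      {g | ∀ u ∈ D, g u [] = c u} ∩ {g | ∑ v ∈ L, X (g v) ∈ F} := by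
    ext g
    refine and_congr_right fun hg => ?_
    have hup : (ofOffspring (glue M g)).upTo M = (ofOffspring c).upTo M := by
      rw [← hA] at hg; exact hg
    have hlev : (ofOffspring (glue M g)).level M = (ofOffspring c).level M := by
      ext u
      have := Set.ext_iff.1 hup u
      constructor
      · rintro ⟨h1, h2⟩; exact ⟨(this.1 ⟨h1, h2.le⟩).1, h2⟩
      · rintro ⟨h1, h2⟩; exact ⟨(this.2 ⟨h1, h2.le⟩).1, h2⟩
    have : (fun j => (ofOffspring (glue M g)).genSize (M + j)) = ∑ v ∈ L, X (g v) := by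
      funext j
      rw [genSize_add, Finset.sum_apply]
      have hLL : ((ofOffspring (glue M g)).finite_level M).toFinset = L := by
        rw [hL]; ext u; simp only [Set.Finite.mem_toFinset, hlev]
      rw [hLL]
      refine Finset.sum_congr rfl fun v hv => ?_
      have hv' := ((hmemL v).1 hv).2
      simp only [glue, splitLabel_append hv', hXdef]
    change (fun j => (ofOffspring (glue M g)).genSize (M + j)) ∈ F ↔ _
    rw [this]
    rfl
  have hFm : MeasurableSet {t : FamilyTree | (fun j => t.genSize (M + j)) ∈ F} :=
    (measurable_pi_iff.2 fun j => measurable_genSize (M + j)) hF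
  have hsumm : Measurable fun g : List ℕ → List ℕ → ℕ => ∑ v ∈ L, X (g v) :=
    Finset.measurable_sum L fun v _ => hX.comp (measurable_pi_apply v)
  rw [hgw, Measure.map_apply hm ((measurableSet_upTo_eq _ _).inter hFm),
    Measure.map_apply hm (measurableSet_upTo_eq _ _), Set.preimage_inter, hA, hB, ← hcard, ← hsum,
    Measure.map_apply hsumm hF]
  have hDLind := hind.indepFun_finset D L hDL fun v => measurable_pi_apply v
  have hset1 : {g : List ℕ → List ℕ → ℕ | ∀ u ∈ D, g u [] = c u} =
      (fun g (u : D) => g u.1) ⁻¹' {x : D → List ℕ → ℕ | ∀ u : D, x u [] = c u.1} := by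
    ext g; simp
  have hset2 : {g : List ℕ → List ℕ → ℕ | ∑ v ∈ L, X (g v) ∈ F} =
      (fun g (u : L) => g u.1) ⁻¹' {x : L → List ℕ → ℕ | ∑ u : L, X (x u) ∈ F} := by
    ext g
    simp only [Set.mem_ofPred_eq, Set.mem_preimage]
    rw [← Finset.sum_coe_sort L (fun v => X (g v))]
  change Q ({g | ∀ u ∈ D, g u [] = c u} ∩ {g | ∑ v ∈ L, X (g v) ∈ F}) =
    Q {g | ∀ u ∈ D, g u [] = c u} * Q {g | ∑ v ∈ L, X (g v) ∈ F}
  rw [hset1, hset2]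
  refine hDLind.measure_inter_preimage_eq_mul _ _ ?_ ?_
  · simp only [Set.ofPred_forall]
    refine MeasurableSet.iInter fun u => ?_
    have : Measurable fun x : D → List ℕ → ℕ => x u [] :=
      (measurable_pi_apply _).comp (measurable_pi_apply _)
    exact this (measurableSet_singleton _)
  · have : Measurable fun x : L → List ℕ → ℕ => ∑ u : L, X (x u) :=
      Finset.measurable_sum _ fun u _ => hX.comp (measurable_pi_apply _)
    exact this hF

/-- The branching property: after generation `M`, the generation sizes form a sum of `Z_M`
independent copies of the sequence of generation sizes. -/
theorem gwLaw_shift (ν : PMF ℕ) (M : ℕ) {F : Set (ℕ → ℕ)} (hF : MeasurableSet F) :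
    gwLaw ν {t | (fun j => t.genSize (M + j)) ∈ F} =
      ∫⁻ t, convPow (pathLaw ν) (t.genSize M) F ∂(gwLaw ν) := by
  simp only [genSize_eq_countLength _ le_rfl (j := M)]
  have h := setLIntegral_upToFinset (gwLaw ν) M (A := Set.univ)
    (fun s => convPow (pathLaw ν) (countLength M s) F)
  rw [setLIntegral_univ] at h
  rw [h, measure_eq_tsum_upToFinset _ M]
  refine tsum_congr fun s => ?_
  rw [Set.inter_univ]
  by_cases hs : ∃ S : FamilyTree, S.upToFinset M = s
  · obtain ⟨S, rfl⟩ := hs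
    have h1 : {t : FamilyTree | t.upToFinset M = S.upToFinset M} = {t | t.upTo M = S.upTo M} := by
      ext t
      exact upToFinset_eq_upToFinset_iff t S M
    rw [h1, branching_upTo ν M S hF, ← genSize_eq_countLength _ le_rfl, mul_comm]
  · have h1 : {t : FamilyTree | t.upToFinset M = s} = ∅ := by
      ext t
      simp only [Set.mem_ofPred_eq, Set.mem_empty_iff_false, iff_false]
      exact fun h => hs ⟨t, h⟩
    simp [h1]

/-- Extinction by generation `M + j` means extinction of each of the `Z_M` independent subtrees by
their generation `j`. It is used with `M = 1` for the recursion and with `M = j` for the size of a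
generation. -/
theorem gwLaw_genSize_add_eq_zero (ν : PMF ℕ) (M j : ℕ) :
    gwLaw ν {t | t.genSize (M + j) = 0} =
      ∫⁻ t, gwLaw ν {t | t.genSize j = 0} ^ t.genSize M ∂(gwLaw ν) := by
  have hF : MeasurableSet {x : ℕ → ℕ | x j = 0} :=
    (measurable_pi_apply j) (measurableSet_singleton 0)
  refine (gwLaw_shift ν M hF).trans (lintegral_congr fun t => ?_)
  rw [convPow_apply_eq_pow (pathLaw ν) hF rfl (fun x y => by simp), pathLaw,
    Measure.map_apply measurable_genSize' hF]
  rfl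

theorem genSize_one_ofOffspring (f : List ℕ → ℕ) : (ofOffspring f).genSize 1 = f [] := by
  have : (ofOffspring f).level 1 = (fun i => [i]) '' (Set.Iio (f [])) := by
    ext u
    simp only [level, Set.mem_ofPred_eq, Set.mem_image, Set.mem_Iio]
    constructor
    · rintro ⟨h1, h2⟩
      obtain ⟨i, rfl⟩ := List.length_eq_one_iff.1 h2
      exact ⟨i, h1.2, rfl⟩
    · rintro ⟨i, hi, rfl⟩
      exact ⟨⟨trivial, hi⟩, rfl⟩
  rw [genSize, this, Set.ncard_image_of_injective _ (fun i j h => by simpa using h)]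
  simp [Set.ncard_eq_toFinset_card']

theorem map_genSize_one (ν : PMF ℕ) :
    (gwLaw ν).map (fun t => t.genSize 1) = ν.toMeasure := by
  rw [gwLaw, Measure.map_map (measurable_genSize 1) measurable_ofOffspring]
  have : (fun t : FamilyTree => t.genSize 1) ∘ ofOffspring = fun f => f [] :=
    funext genSize_one_ofOffspring
  rw [this]
  exact Measure.infinitePi_map_eval (fun _ : List ℕ => ν.toMeasure) []

/-- Events that depend on the first `k` generations only, under the law of the incipient infinite
cluster. -/
theorem IsIICLaw.apply_upToFinset {ν : PMF ℕ} {P : Measure FamilyTree} (hP : IsIICLaw ν P) (k : ℕ)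
    (B : Set (Finset (List ℕ))) :
    P {t | t.upToFinset k ∈ B} = ∫⁻ t in {t | t.upToFinset k ∈ B}, t.genSize k ∂(gwLaw ν) := by
  simp only [genSize_eq_countLength _ le_rfl (j := k)]
  rw [setLIntegral_upToFinset (gwLaw ν) k (fun s => (countLength k s : ℝ≥0∞)),
    measure_eq_tsum_upToFinset _ k]
  refine tsum_congr fun s => ?_
  by_cases hs : s ∈ B
  · have h0 : {t : FamilyTree | t.upToFinset k = s} ∩ {t | t.upToFinset k ∈ B} =
        {t | t.upToFinset k = s} :=
      Set.inter_eq_left.2 fun t (ht : _ = s) => by simpa [ht] using hs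
    rw [h0]
    by_cases hS : ∃ S : FamilyTree, S.upToFinset k = s
    · obtain ⟨S, rfl⟩ := hS
      have h1 : {t : FamilyTree | t.upToFinset k = S.upToFinset k} =
          {t | t.upTo k = S.upTo k} := by
        ext t
        exact upToFinset_eq_upToFinset_iff t S k
      rw [h1, hP.2 k S, ← genSize_eq_countLength _ le_rfl]
      rfl
    · have h1 : {t : FamilyTree | t.upToFinset k = s} = ∅ := by
        ext t
        simp only [Set.mem_ofPred_eq, Set.mem_empty_iff_false, iff_false]
        exact fun h => hS ⟨t, h⟩
      simp [h1]
  · have h0 : {t : FamilyTree | t.upToFinset k = s} ∩ {t | t.upToFinset k ∈ B} = ∅ := by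
      ext t
      simp only [Set.mem_inter_iff, Set.mem_ofPred_eq, Set.mem_empty_iff_false, iff_false]
      rintro ⟨rfl, h⟩
      exact hs h
    simp [h0]

/-! ## The generating function of a critical offspring distribution -/

/-- The divided difference `(k s - 1 + (1 - s) ^ k) / s`. -/
noncomputable def powExcess (k : ℕ) (s : ℝ) : ℝ := ∑ j ∈ Finset.range k, (1 - (1 - s) ^ j)

theorem powExcess_nonneg (k : ℕ) {s : ℝ} (h0 : 0 ≤ s) (h1 : s ≤ 1) : 0 ≤ powExcess k s :=
  Finset.sum_nonneg fun j _ => sub_nonneg.2 (pow_le_one₀ (by linarith) (by linarith))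

theorem powExcess_le (k : ℕ) {s : ℝ} (h1 : s ≤ 1) : powExcess k s ≤ k := by
  calc powExcess k s ≤ ∑ _ ∈ Finset.range k, (1 : ℝ) :=
        Finset.sum_le_sum fun j _ => sub_le_self _ (pow_nonneg (by linarith) j)
    _ = k := by simp

theorem powExcess_mono (k : ℕ) {s s' : ℝ} (h : s ≤ s') (h1 : s' ≤ 1) :
    powExcess k s ≤ powExcess k s' :=
  Finset.sum_le_sum fun j _ => sub_le_sub_left (pow_le_pow_left₀ (by linarith) (by linarith) j) 1

/-- Convexity of `x ^ j`, with `1 - s` the midpoint of `1` and `1 - 2 * s`. -/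
theorem powExcess_two_mul_le (k : ℕ) {s : ℝ} (h1 : 2 * s ≤ 1) :
    powExcess k (2 * s) ≤ 2 * powExcess k s := by
  rw [powExcess, powExcess, Finset.mul_sum]
  refine Finset.sum_le_sum fun j _ => ?_
  have h2 := (convexOn_pow (𝕜 := ℝ) j).2 (show (1 : ℝ) ∈ Set.Ici 0 by simp)
    (show 1 - 2 * s ∈ Set.Ici (0 : ℝ) from Set.mem_Ici.2 (by linarith))
    (show (0 : ℝ) ≤ 1 / 2 by norm_num) (show (0 : ℝ) ≤ 1 / 2 by norm_num) (by norm_num)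
  simp only [smul_eq_mul, one_pow] at h2
  rw [show (1 / 2 * 1 + 1 / 2 * (1 - 2 * s) : ℝ) = 1 - s by ring] at h2
  linarith

theorem one_sub_pow_eq (k : ℕ) (s : ℝ) : (1 - s) ^ k = 1 - k * s + s * powExcess k s := by
  induction k with
  | zero => simp [powExcess]
  | succ k ih =>
    rw [powExcess, Finset.sum_range_succ, ← powExcess, mul_add, pow_succ, mul_sub, mul_one, ih]
    push_cast; ring

theorem powExcess_pos {k : ℕ} (hk : 2 ≤ k) {s : ℝ} (h0 : 0 < s) (h1 : s ≤ 1) :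
    0 < powExcess k s := by
  have hle : ∀ j ∈ Finset.range k, 0 ≤ 1 - (1 - s) ^ j := fun j _ =>
    sub_nonneg.2 (pow_le_one₀ (by linarith) (by linarith))
  refine Finset.sum_pos' hle ⟨1, Finset.mem_range.2 (by omega), by simpa using h0⟩

/-- For a mean-one distribution `ν`, the function `s ↦ (f (1 - s) - (1 - s)) / s`, where `f` is the
generating function of `ν`. -/
noncomputable def excess (ν : PMF ℕ) (s : ℝ) : ℝ := ∑' k, (ν k).toReal * powExcess k s

section Excess

variable {ν : PMF ℕ}

theorem hasSum_toReal (ν : PMF ℕ) : HasSum (fun k => (ν k).toReal) 1 := by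
  have h := ENNReal.hasSum_toReal (f := ν) (by rw [ν.tsum_coe]; exact ENNReal.one_ne_top)
  rwa [← ENNReal.tsum_toReal_eq fun k => ν.apply_ne_top k, ν.tsum_coe, ENNReal.toReal_one] at h

theorem IsCritical.hasSum_mean (hν : IsCritical ν) : HasSum (fun k : ℕ => (ν k).toReal * k) 1 := by
  have hν' : ∑' n : ℕ, (n : ℝ≥0∞) * ν n = 1 := hν
  have h := ENNReal.hasSum_toReal (f := fun n : ℕ => (n : ℝ≥0∞) * ν n)
    (by rw [hν']; exact ENNReal.one_ne_top)
  rw [← ENNReal.tsum_toReal_eq fun k =>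
    ENNReal.mul_ne_top (ENNReal.natCast_ne_top k) (ν.apply_ne_top k), hν', ENNReal.toReal_one] at h
  simpa [mul_comm] using h

theorem summable_excess (hν : IsCritical ν) {s : ℝ} (h0 : 0 ≤ s) (h1 : s ≤ 1) :
    Summable fun k => (ν k).toReal * powExcess k s :=
  Summable.of_nonneg_of_le
    (fun k => mul_nonneg ENNReal.toReal_nonneg (powExcess_nonneg k h0 h1))
    (fun k => mul_le_mul_of_nonneg_left (powExcess_le k h1) ENNReal.toReal_nonneg)
    hν.hasSum_mean.summable

theorem excess_nonneg {s : ℝ} (h0 : 0 ≤ s) (h1 : s ≤ 1) : 0 ≤ excess ν s :=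
  tsum_nonneg fun k => mul_nonneg ENNReal.toReal_nonneg (powExcess_nonneg k h0 h1)

theorem excess_le_one (hν : IsCritical ν) {s : ℝ} (h0 : 0 ≤ s) (h1 : s ≤ 1) : excess ν s ≤ 1 := by
  rw [← hν.hasSum_mean.tsum_eq]
  exact (summable_excess hν h0 h1).tsum_le_tsum
    (fun k => mul_le_mul_of_nonneg_left (powExcess_le k h1) ENNReal.toReal_nonneg)
    hν.hasSum_mean.summable

theorem excess_mono (hν : IsCritical ν) {s s' : ℝ} (h0 : 0 ≤ s) (h : s ≤ s') (h1 : s' ≤ 1) :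
    excess ν s ≤ excess ν s' :=
  (summable_excess hν h0 (h.trans h1)).tsum_le_tsum
    (fun k => mul_le_mul_of_nonneg_left (powExcess_mono k h h1) ENNReal.toReal_nonneg)
    (summable_excess hν (h0.trans h) h1)

theorem excess_two_mul_le (hν : IsCritical ν) {s : ℝ} (h0 : 0 ≤ s) (h1 : 2 * s ≤ 1) :
    excess ν (2 * s) ≤ 2 * excess ν s := by
  rw [excess, excess, ← tsum_mul_left]
  refine (summable_excess hν (by linarith) h1).tsum_le_tsum (fun k => ?_)
    ((summable_excess hν h0 (by linarith)).mul_left 2)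
  rw [mul_left_comm]
  exact mul_le_mul_of_nonneg_left (powExcess_two_mul_le k h1) ENNReal.toReal_nonneg

/-- Mean one makes the linear term of the generating function at `1 - s` exactly `-s`; the excess is
the whole correction. -/
theorem hasSum_one_sub_pow (hν : IsCritical ν) {s : ℝ} (h0 : 0 ≤ s) (h1 : s ≤ 1) :
    HasSum (fun k => (ν k).toReal * (1 - s) ^ k) (1 - s + s * excess ν s) := by
  have h := ((hasSum_toReal ν).sub (hν.hasSum_mean.mul_right s)).add
    ((summable_excess hν h0 h1).hasSum.mul_left s)
  rw [one_mul] at h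
  refine h.congr_fun fun k => ?_
  rw [one_sub_pow_eq]; ring

/-- Positivity of the excess does not depend on the argument. -/
theorem excess_pos_of_pos (hν : IsCritical ν) {s s' : ℝ} (h : 0 < excess ν s)
    (h0 : 0 < s') (h1 : s' ≤ 1) : 0 < excess ν s' := by
  by_contra hle
  have hzero : excess ν s' = 0 := le_antisymm (not_lt.1 hle) (excess_nonneg h0.le h1)
  have hk : ∀ k, (ν k).toReal * powExcess k s' = 0 := fun k => by
    have hsum := (summable_excess hν h0.le h1).hasSum
    rw [← excess, hzero] at hsum
    exact congrFun ((hasSum_zero_iff_of_nonneg fun k =>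
      mul_nonneg ENNReal.toReal_nonneg (powExcess_nonneg k h0.le h1)).1 hsum) k
  refine h.ne' ?_
  have : ∀ k, (ν k).toReal * powExcess k s = 0 := fun k => by
    -- Family sizes below `2` contribute nothing for any argument, and a vanishing excess at `s'`
    -- rules out all larger ones.
    rcases Nat.lt_or_ge k 2 with hk2 | hk2
    · interval_cases k <;> simp [powExcess]
    · rcases mul_eq_zero.1 (hk k) with h3 | h3
      · rw [h3, zero_mul]
      · exact absurd h3 (powExcess_pos hk2 h0 h1).ne'
  simp [excess, this]

end Excess

/-! ## Sums of independent variables in the domain of attraction of a stable law -/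

section Laplace

variable {ν : PMF ℕ}

/-- The law of a sequence of independent variables with law `ν`. -/
noncomputable abbrev iidLaw (ν : PMF ℕ) : Measure (ℕ → ℕ) :=
  Measure.infinitePi fun _ : ℕ => ν.toMeasure

theorem integral_one_sub_pow (hν : IsCritical ν) {s : ℝ} (h0 : 0 ≤ s) (h1 : s ≤ 1) :
    ∫ k, (1 - s) ^ k ∂ν.toMeasure = 1 - s + s * excess ν s := by
  have hint : Integrable (fun k : ℕ => (1 - s) ^ k) ν.toMeasure := by
    refine Integrable.of_bound Measurable.of_discrete.aestronglyMeasurable 1 (ae_of_all _ fun k => ?_)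
    rw [Real.norm_of_nonneg (pow_nonneg (by linarith) k)]
    exact pow_le_one₀ (by linarith) (by linarith)
  rw [PMF.integral_eq_tsum _ _ hint, ← (hasSum_one_sub_pow hν h0 h1).tsum_eq]
  rfl

/-- The Laplace transform of the centred sums. -/
theorem integral_exp_centredSum (hν : IsCritical ν) {t : ℝ} (ht : 0 ≤ t) (n : ℕ) :
    ∫ ξ, Real.exp (-t * ((∑ i ∈ Finset.range n, (ξ i : ℝ)) - n)) ∂(iidLaw ν) =
      (1 + (1 - Real.exp (-t)) * excess ν (1 - Real.exp (-t)) / Real.exp (-t)) ^ n := by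
  have hexp : Real.exp (-t) ≤ 1 := Real.exp_le_one_iff.2 (by linarith)
  have hind : iIndepFun (fun (i : ℕ) (ξ : ℕ → ℕ) => (ξ i : ℝ)) (iidLaw ν) :=
    iIndepFun_infinitePi (X := fun _ (k : ℕ) => (k : ℝ)) fun _ => Measurable.of_discrete
  have hmgf := hind.mgf_sum (t := -t)
    (fun i => (Measurable.of_discrete (f := fun k : ℕ => (k : ℝ))).comp (measurable_pi_apply i))
    (Finset.range n)
  have h1 : ∀ i : ℕ, mgf (fun ξ : ℕ → ℕ => (ξ i : ℝ)) (iidLaw ν) (-t) =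
      Real.exp (-t) + (1 - Real.exp (-t)) * excess ν (1 - Real.exp (-t)) := by
    intro i
    have h2 := integral_one_sub_pow hν (s := 1 - Real.exp (-t)) (by linarith)
      (by linarith [Real.exp_pos (-t)])
    rw [sub_sub_cancel] at h2
    have hmap : (iidLaw ν).map (fun ξ => ξ i) = ν.toMeasure :=
      Measure.infinitePi_map_eval (fun _ : ℕ => ν.toMeasure) i
    rw [← h2, mgf, ← hmap, integral_map (measurable_pi_apply i).aemeasurable
      Measurable.of_discrete.aestronglyMeasurable]
    refine integral_congr_ae (ae_of_all _ fun ξ => ?_)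
    simp only
    rw [← Real.exp_nat_mul, mul_comm]
  rw [Finset.prod_congr rfl fun i _ => h1 i, Finset.prod_const, Finset.card_range] at hmgf
  have h3 : ∀ ξ : ℕ → ℕ, Real.exp (-t * ((∑ i ∈ Finset.range n, (ξ i : ℝ)) - n)) =
      Real.exp (-t * (∑ i ∈ Finset.range n, fun ξ : ℕ → ℕ => (ξ i : ℝ)) ξ) *
        ((Real.exp (-t))⁻¹) ^ n := by
    intro ξ
    rw [← Real.exp_neg, ← Real.exp_nat_mul, ← Real.exp_add, Finset.sum_apply]
    congr 1; ring
  simp only [h3]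
  rw [integral_mul_const]
  change mgf _ _ _ * _ = _
  rw [hmgf, ← mul_pow]
  congr 1
  field_simp

theorem integrable_exp_centredSum (ν : PMF ℕ) {t : ℝ} (ht : 0 ≤ t) (n : ℕ) :
    Integrable (fun ξ : ℕ → ℕ => Real.exp (-t * ((∑ i ∈ Finset.range n, (ξ i : ℝ)) - n)))
      (iidLaw ν) := by
  refine Integrable.of_bound (Measurable.aestronglyMeasurable ?_) (Real.exp (t * n))
    (ae_of_all _ fun ξ => ?_)
  · have : ∀ i, Measurable fun ξ : ℕ → ℕ => (ξ i : ℝ) := fun i =>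
      (Measurable.of_discrete (f := fun k : ℕ => (k : ℝ))).comp (measurable_pi_apply i)
    fun_prop
  · rw [Real.norm_of_nonneg (Real.exp_pos _).le, Real.exp_le_exp]
    have : 0 ≤ ∑ i ∈ Finset.range n, (ξ i : ℝ) := Finset.sum_nonneg fun i _ => Nat.cast_nonneg _
    nlinarith

/-- `(f (1 - s) - (1 - s)) / (1 - s)`. -/
noncomputable def relExcess (ν : PMF ℕ) (s : ℝ) : ℝ := s * excess ν s / (1 - s)

theorem integral_exp_centredSum' (hν : IsCritical ν) {t : ℝ} (ht : 0 ≤ t) (n : ℕ) :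
    ∫ ξ, Real.exp (-t * ((∑ i ∈ Finset.range n, (ξ i : ℝ)) - n)) ∂(iidLaw ν) =
      (1 + relExcess ν (1 - Real.exp (-t))) ^ n := by
  rw [integral_exp_centredSum hν ht, relExcess, sub_sub_cancel]

theorem relExcess_nonneg {s : ℝ} (h0 : 0 ≤ s) (h1 : s ≤ 1) : 0 ≤ relExcess ν s :=
  div_nonneg (mul_nonneg h0 (excess_nonneg h0 h1)) (by linarith)

theorem relExcess_mono (hν : IsCritical ν) {s s' : ℝ} (h0 : 0 ≤ s) (h : s ≤ s') (h1 : s' < 1) :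
    relExcess ν s ≤ relExcess ν s' := by
  have h2 : (0 : ℝ) < 1 - s' := by linarith
  have h3 := excess_mono hν h0 h h1.le
  have h4 := excess_nonneg (ν := ν) h0 (h.trans h1.le)
  have h5 : 0 ≤ s' := h0.trans h
  exact div_le_div₀ (mul_nonneg h5 (h4.trans h3)) (mul_le_mul h h3 h4 h5) h2 (by linarith)

/-- A lower bound for the probability that a centred sum is very negative. -/
theorem le_measure_centredSum (hν : IsCritical ν) {s : ℝ} (h0 : 0 < s) (h1 : s ≤ 1 / 2) {n : ℕ}
    (h3 : 3 ≤ n * relExcess ν s) (h4 : n * relExcess ν s ≤ 4) :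
    Real.exp (-32) ≤ (iidLaw ν).real {ξ | (∑ i ∈ Finset.range n, (ξ i : ℝ)) - n ≤
      -(Real.log 2 / -Real.log (1 - s))} := by
  set t := -Real.log (1 - s) with ht
  have hs1 : 0 < 1 - s := by linarith
  have hexp : Real.exp (-t) = 1 - s := by rw [ht, neg_neg, Real.exp_log hs1]
  have htpos : 0 < t := by rw [ht]; exact neg_pos.2 (Real.log_neg hs1 (by linarith))
  set A := {ξ : ℕ → ℕ | (∑ i ∈ Finset.range n, (ξ i : ℝ)) - n ≤ -(Real.log 2 / t)} with hA
  have hAm : MeasurableSet A := by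
    have : ∀ i, Measurable fun ξ : ℕ → ℕ => (ξ i : ℝ) := fun i =>
      (Measurable.of_discrete (f := fun k : ℕ => (k : ℝ))).comp (measurable_pi_apply i)
    exact measurableSet_le (by fun_prop) measurable_const
  set W := fun ξ : ℕ → ℕ => Real.exp (-t * ((∑ i ∈ Finset.range n, (ξ i : ℝ)) - n)) with hW
  have hWint : Integrable W (iidLaw ν) := integrable_exp_centredSum ν htpos.le n
  have hW2 : (fun ξ => W ξ ^ 2) = fun ξ : ℕ → ℕ =>
      Real.exp (-(2 * t) * ((∑ i ∈ Finset.range n, (ξ i : ℝ)) - n)) := by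
    funext ξ
    rw [hW, ← Real.exp_nat_mul]
    congr 1; push_cast; ring
  have hW2int : Integrable (fun ξ => W ξ ^ 2) (iidLaw ν) := by
    rw [hW2]; exact integrable_exp_centredSum ν (by linarith) n
  -- Bernoulli's inequality: `(1 + r)^n ≥ 1 + n r ≥ 4`.
  have hEW : 4 ≤ ∫ ξ, W ξ ∂(iidLaw ν) := by
    rw [hW, integral_exp_centredSum' hν htpos.le, hexp, sub_sub_cancel]
    have := one_add_mul_le_pow (a := relExcess ν s)
      (by linarith [relExcess_nonneg (ν := ν) h0.le (by linarith)]) n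
    linarith
  have hEW2 : ∫ ξ, W ξ ^ 2 ∂(iidLaw ν) ≤ Real.exp 32 := by
    have hexp2 : Real.exp (-(2 * t)) = (1 - s) ^ 2 := by
      rw [← hexp, ← Real.exp_nat_mul]; congr 1; push_cast; ring
    set s2 := 1 - (1 - s) ^ 2 with hs2
    have hs2le : s2 ≤ 2 * s := by nlinarith
    have hs20 : 0 ≤ s2 := by nlinarith
    have hs21 : s2 ≤ 1 := by nlinarith
    -- Squaring `W` doubles `t`, hence at most doubles `s`. The factor `8` is `2` from `s`, `2` from
    -- the excess, and `2` from the denominator since `1 - s ≥ 1/2`. With `n r ≤ 4` this yields `exp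
    -- 32`.
    have hrel : relExcess ν s2 ≤ 8 * relExcess ν s := by
      have hg : excess ν s2 ≤ 2 * excess ν s :=
        (excess_mono hν hs20 hs2le (by linarith)).trans (excess_two_mul_le hν h0.le (by linarith))
      have hg0 := excess_nonneg (ν := ν) h0.le (by linarith)
      have hg2 := excess_nonneg (ν := ν) hs20 hs21
      rw [relExcess, relExcess, hs2, sub_sub_cancel, ← hs2, div_le_iff₀ (by positivity)]
      have h5 : s2 * excess ν s2 ≤ 4 * (s * excess ν s) := by
        calc s2 * excess ν s2 ≤ (2 * s) * (2 * excess ν s) :=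
              mul_le_mul hs2le hg hg2 (by linarith)
          _ = _ := by ring
      have h6 : 8 * (s * excess ν s / (1 - s)) * (1 - s) ^ 2 = 8 * (s * excess ν s) * (1 - s) := by
        field_simp
      rw [h6]
      have h7 : 0 ≤ s * excess ν s := by positivity
      nlinarith
    have h2t : 0 ≤ 2 * t := by linarith
    rw [hW2, integral_exp_centredSum' hν h2t, hexp2]
    calc (1 + relExcess ν s2) ^ n ≤ Real.exp (relExcess ν s2) ^ n := by
          refine pow_le_pow_left₀ (by linarith [relExcess_nonneg (ν := ν) hs20 hs21]) ?_ n
          linarith [Real.add_one_le_exp (relExcess ν s2)]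
      _ = Real.exp (n * relExcess ν s2) := (Real.exp_nat_mul _ _).symm
      _ ≤ Real.exp 32 := by
          rw [Real.exp_le_exp]
          have : (n : ℝ) * relExcess ν s2 ≤ n * (8 * relExcess ν s) := by gcongr
          linarith
  -- Second-moment method: off `A` one has `W ≤ 2`, and on `A` the AM–GM inequality is weighted so
  -- that the square term integrates to at most `1/2`. As `E W ≥ 4`, the event `A` must carry the
  -- rest.
  have hpt : ∀ ξ, W ξ ≤ 2 + Real.exp (-32) / 2 * W ξ ^ 2 +
      A.indicator (fun _ => Real.exp 32 / 2) ξ := by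
    intro ξ
    have hee : Real.exp (-32) * Real.exp 32 = 1 := by rw [← Real.exp_add]; simp
    by_cases hξ : ξ ∈ A
    · rw [Set.indicator_of_mem hξ]
      have : 0 ≤ Real.exp (-32) * (W ξ - Real.exp 32) ^ 2 := by positivity
      have h5 : Real.exp (-32) * (W ξ - Real.exp 32) ^ 2 =
          Real.exp (-32) * W ξ ^ 2 - 2 * W ξ * (Real.exp (-32) * Real.exp 32) +
          Real.exp (-32) * Real.exp 32 * Real.exp 32 := by ring
      rw [h5, hee] at this
      linarith
    · rw [Set.indicator_of_notMem hξ]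
      have hlt : -(Real.log 2 / t) < (∑ i ∈ Finset.range n, (ξ i : ℝ)) - n := not_le.1 hξ
      have h5 : W ξ ≤ 2 := by
        rw [← Real.exp_log (show (0 : ℝ) < 2 by norm_num), hW]
        refine Real.exp_le_exp.2 ?_
        rw [neg_lt, lt_div_iff₀ htpos] at hlt
        linarith
      have : 0 ≤ Real.exp (-32) / 2 * W ξ ^ 2 := by positivity
      linarith
  have hint : ∫ ξ, W ξ ∂(iidLaw ν) ≤ 2 + Real.exp (-32) / 2 * ∫ ξ, W ξ ^ 2 ∂(iidLaw ν) +
      Real.exp 32 / 2 * (iidLaw ν).real A := by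
    have hi1 : Integrable (fun ξ => 2 + Real.exp (-32) / 2 * W ξ ^ 2) (iidLaw ν) :=
      (integrable_const _).add (hW2int.const_mul _)
    have hi2 : Integrable (A.indicator fun _ => Real.exp 32 / 2) (iidLaw ν) :=
      (integrable_const _).indicator hAm
    have h6 := integral_mono hWint (hi1.add hi2) hpt
    have h7 : ∫ ξ, (2 + Real.exp (-32) / 2 * W ξ ^ 2 +
        A.indicator (fun _ => Real.exp 32 / 2) ξ) ∂(iidLaw ν) =
        2 + Real.exp (-32) / 2 * ∫ ξ, W ξ ^ 2 ∂(iidLaw ν) +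
          Real.exp 32 / 2 * (iidLaw ν).real A := by
      rw [integral_add hi1 hi2, integral_add (integrable_const _) (hW2int.const_mul _),
        integral_const_mul, integral_indicator_const _ hAm]
      simp [mul_comm]
    exact h6.trans h7.le
  have hee : Real.exp (-32) * Real.exp 32 = 1 := by rw [← Real.exp_add]; simp
  have h8 : Real.exp (-32) / 2 * ∫ ξ, W ξ ^ 2 ∂(iidLaw ν) ≤ 1 / 2 := by
    calc _ ≤ Real.exp (-32) / 2 * Real.exp 32 := by gcongr
      _ = 1 / 2 := by rw [div_mul_eq_mul_div, hee]
  have h9 : 2 ≤ Real.exp 32 * (iidLaw ν).real A := by linarith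
  calc Real.exp (-32) = Real.exp (-32) * 1 := (mul_one _).symm
    _ ≤ Real.exp (-32) * (Real.exp 32 * (iidLaw ν).real A) := by gcongr; linarith
    _ = (iidLaw ν).real A := by rw [← mul_assoc, hee, one_mul]

end Laplace

/-! ### Growth of the excess for laws in a stable domain of attraction -/

section StableDomain

variable {ν : PMF ℕ} {α : ℝ}

/-- The consequences of `InStableDomain` used below: a lower bound for the Laplace transforms, and
tightness from below. -/
theorem InStableDomain.exists_normalization (hν : IsCritical ν) (h : InStableDomain α ν) :
    ∃ a : ℕ → ℝ, (∀ n, 0 < a n) ∧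
      (∀ θ : ℝ, 0 ≤ θ → ∀ᶠ n : ℕ in atTop,
        θ ^ α - 1 < n * relExcess ν (1 - Real.exp (-(θ / a n)))) ∧
      ∀ δ : ℝ, 0 < δ → ∃ R : ℝ, 0 < R ∧ ∀ᶠ n : ℕ in atTop,
        (iidLaw ν).real {ξ | (∑ i ∈ Finset.range n, (ξ i : ℝ)) - n ≤ -(R * a n)} < δ := by
  obtain ⟨a, ha, ρ, hρ, htend⟩ := h
  refine ⟨a, ha, fun θ hθ => ?_, fun δ hδ => ?_⟩
  -- The function `exp (-θ x)` is unbounded, so convergence in law only gives lower semicontinuity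
  -- of its integral, and that is the direction needed. The bound `(1 + r)^n ≤ exp (n r)` then makes
  -- it a lower bound for `n r`.
  · have hopen := fun G (hG : IsOpen G) =>
      ProbabilityMeasure.le_liminf_measure_open_of_tendsto htend.tendsto hG
    have hcont : Continuous fun x : ℝ => Real.exp (-θ * x) := by fun_prop
    have hl := lintegral_le_liminf_lintegral_of_forall_isOpen_measure_le_liminf_measure
      (f := fun x : ℝ => Real.exp (-θ * x)) hcont (fun x => (Real.exp_pos _).le) hopen
    have hlim : ∫⁻ x, ENNReal.ofReal (Real.exp (-θ * x)) ∂((ρ : Measure ℝ).map id) =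
        ENNReal.ofReal (Real.exp (θ ^ α)) := by
      rw [Measure.map_id, ← (hρ θ hθ).2, ofReal_integral_eq_lintegral_ofReal (hρ θ hθ).1
        (ae_of_all _ fun x => (Real.exp_pos _).le)]
    change ∫⁻ x, ENNReal.ofReal (Real.exp (-θ * x)) ∂((ρ : Measure ℝ).map id) ≤ _ at hl
    rw [hlim] at hl
    have hlt : ENNReal.ofReal (Real.exp (θ ^ α - 1)) < ENNReal.ofReal (Real.exp (θ ^ α)) := by
      rw [ENNReal.ofReal_lt_ofReal_iff (Real.exp_pos _), Real.exp_lt_exp]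
      linarith
    filter_upwards [eventually_lt_of_lt_liminf (hlt.trans_le hl)] with n hn
    have hθn : 0 ≤ θ / a n := div_nonneg hθ (ha n).le
    have hmap : ∫⁻ x, ENNReal.ofReal (Real.exp (-θ * x)) ∂((iidLaw ν).map
        fun ξ : ℕ → ℕ => ((∑ i ∈ Finset.range n, (ξ i : ℝ)) - n) / a n) =
        ENNReal.ofReal ((1 + relExcess ν (1 - Real.exp (-(θ / a n)))) ^ n) := by
      rw [lintegral_map' (by fun_prop) (htend.forall_aemeasurable n),
        ← integral_exp_centredSum' hν hθn, ofReal_integral_eq_lintegral_ofReal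
        (integrable_exp_centredSum ν hθn n) (ae_of_all _ fun x => (Real.exp_pos _).le)]
      refine lintegral_congr fun ξ => ?_
      congr 2
      ring
    change _ < ∫⁻ x, ENNReal.ofReal (Real.exp (-θ * x)) ∂((iidLaw ν).map
        fun ξ : ℕ → ℕ => ((∑ i ∈ Finset.range n, (ξ i : ℝ)) - n) / a n) at hn
    rw [hmap] at hn
    set r := relExcess ν (1 - Real.exp (-(θ / a n))) with hr
    have hr0 : 0 ≤ r := relExcess_nonneg
      (by linarith [Real.exp_le_one_iff.2 (show -(θ / a n) ≤ 0 by linarith)])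
      (by linarith [Real.exp_pos (-(θ / a n))])
    have hn' := (ENNReal.ofReal_lt_ofReal_iff_of_nonneg (Real.exp_pos _).le).1 hn
    have hle : (1 + r) ^ n ≤ Real.exp (n * r) := by
      rw [Real.exp_nat_mul]
      exact pow_le_pow_left₀ (by linarith) (by linarith [Real.add_one_le_exp r]) n
    exact Real.exp_lt_exp.1 (hn'.trans_le hle)
  · have hbot := tendsto_cdf_atBot (ρ : Measure ℝ)
    have hev := (hbot.eventually_lt_const hδ).and (eventually_lt_atBot 0)
    obtain ⟨x, hx, hx0⟩ := hev.exists
    replace hx := (ENNReal.ofReal_lt_ofReal_iff hδ).2 hx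
    rw [ofReal_cdf] at hx
    refine ⟨-x, by linarith, ?_⟩
    have hlimsup := ProbabilityMeasure.limsup_measure_closed_le_of_tendsto htend.tendsto
      (isClosed_Iic (a := x))
    change _ ≤ ((ρ : Measure ℝ).map id) (Set.Iic x) at hlimsup
    rw [Measure.map_id] at hlimsup
    filter_upwards [eventually_lt_of_limsup_lt (hlimsup.trans_lt hx)] with n hn
    change ((iidLaw ν).map fun ξ : ℕ → ℕ => ((∑ i ∈ Finset.range n, (ξ i : ℝ)) - n) / a n)
      (Set.Iic x) < _ at hn
    rw [Measure.map_apply_of_aemeasurable (htend.forall_aemeasurable n) measurableSet_Iic] at hn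
    have hset : {ξ : ℕ → ℕ | (∑ i ∈ Finset.range n, (ξ i : ℝ)) - n ≤ -(-x * a n)} =
        (fun ξ : ℕ → ℕ => ((∑ i ∈ Finset.range n, (ξ i : ℝ)) - n) / a n) ⁻¹' Set.Iic x := by
      ext ξ
      simp only [Set.mem_ofPred_eq, Set.mem_preimage, Set.mem_Iic, div_le_iff₀ (ha n)]
      rw [neg_mul, neg_neg]
    rw [hset, measureReal_def]
    exact ENNReal.toReal_lt_of_lt_ofReal hn

/-- An offspring distribution in the domain of attraction of a stable law is not degenerate. -/
theorem InStableDomain.excess_pos (hα : 1 < α) (hν : IsCritical ν) (h : InStableDomain α ν)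
    {s : ℝ} (h0 : 0 < s) (h1 : s ≤ 1) : 0 < excess ν s := by
  obtain ⟨a, ha, hlow, -⟩ := h.exists_normalization hν
  -- At `θ = 2` the lower bound `2 ^ α - 1` is positive, so the excess cannot vanish.
  obtain ⟨n, hn⟩ := (hlow 2 (by norm_num)).exists
  set r := 1 - Real.exp (-(2 / a n)) with hr
  have hr0 : 0 ≤ r := by
    have : Real.exp (-(2 / a n)) ≤ 1 :=
      Real.exp_le_one_iff.2 (neg_nonpos.2 (div_nonneg (by norm_num) (ha n).le))
    linarith
  have hr1 : r ≤ 1 := by linarith [Real.exp_pos (-(2 / a n))]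
  have h2 : (1 : ℝ) < 2 ^ α := Real.one_lt_rpow (by norm_num) (by linarith)
  refine excess_pos_of_pos hν (s := r) ?_ h0 h1
  refine lt_of_le_of_ne (excess_nonneg hr0 hr1) fun h3 => ?_
  rw [relExcess, ← h3] at hn
  simp at hn
  linarith

/-- The excess grows at least like a power: this is where the index of the stable law enters. -/
theorem InStableDomain.excess_growth (hα : 1 < α) (hν : IsCritical ν) (h : InStableDomain α ν) :
    ∃ b s₀ : ℝ, 1 < b ∧ 0 < s₀ ∧ ∀ s, 0 < s → s ≤ s₀ → b * s ≤ 1 ∧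
      2 * excess ν s ≤ excess ν (b * s) := by
  obtain ⟨a, ha, hlow, htight⟩ := h.exists_normalization hν
  -- The level `exp (-32)` is the one that `le_measure_centredSum` will contradict.
  obtain ⟨R, hR, hRev⟩ := htight (Real.exp (-32)) (Real.exp_pos _)
  set θ₀ := Real.log 2 / R with hθ₀
  have hlog2 : 0 < Real.log 2 := Real.log_pos (by norm_num)
  have hθ₀pos : 0 < θ₀ := div_pos hlog2 hR
  -- Here `α > 1` enters: `(b θ₀)^α` outgrows `32 b`. The constant is `8 · 4`, with `4` the upper
  -- bound for `n r` and `8 b` the factor wanted between `relExcess` at `s` and at `2 b s`.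
  obtain ⟨b, hb1, hb⟩ : ∃ b : ℝ, 1 ≤ b ∧ 32 * b ≤ (b * θ₀) ^ α - 1 := by
    have h1 : Tendsto (fun x : ℝ => x ^ (α - 1)) atTop atTop := tendsto_rpow_atTop (by linarith)
    have h2 := (h1.eventually_ge_atTop (33 / θ₀ ^ α)).and (eventually_ge_atTop 1)
    obtain ⟨b, hb, hb1⟩ := h2.exists
    refine ⟨b, hb1, ?_⟩
    have hbpos : 0 < b := by linarith
    have h3 : (b * θ₀) ^ α = b * (b ^ (α - 1) * θ₀ ^ α) := by
      rw [Real.mul_rpow hbpos.le hθ₀pos.le, ← mul_assoc]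
      congr 1
      rw [Real.rpow_sub_one hbpos.ne']
      field_simp
    rw [div_le_iff₀ (Real.rpow_pos_of_pos hθ₀pos α)] at hb
    rw [h3]
    nlinarith
  obtain ⟨n₀, hn₀⟩ := eventually_atTop.1 (hRev.and (hlow (b * θ₀) (by positivity)))
  -- The first bound on `s` keeps `2 b s ≤ 1/2`; the second forces the `n` chosen below to be at
  -- least `n₀`. The extra factor `2` in `2 b` absorbs `-log (1 - s) ≤ 2 s`.
  refine ⟨2 * b, min (1 / (4 * b)) (1 / (n₀ + 1)), by linarith, by positivity, fun s hs0 hs => ?_⟩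
  have hsb : s ≤ 1 / (4 * b) := hs.trans (min_le_left _ _)
  have hsn : s ≤ 1 / (n₀ + 1) := hs.trans (min_le_right _ _)
  have hsb' : 2 * b * s ≤ 1 / 2 := by
    rw [le_div_iff₀ (by positivity)] at hsb
    linarith
  have hs4 : s ≤ 1 / 4 := by nlinarith
  refine ⟨by linarith, ?_⟩
  have hg := h.excess_pos hα hν hs0 (by linarith)
  set r := relExcess ν s with hr
  have hrpos : 0 < r := div_pos (mul_pos hs0 hg) (by linarith)
  have hr1 : r ≤ 4 / 3 * s := by
    rw [hr, relExcess, div_le_iff₀ (by linarith)]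
    have := excess_le_one hν hs0.le (by linarith : s ≤ 1)
    nlinarith
  set n := ⌊3 / r⌋₊ + 1 with hn
  have hn3 : 3 ≤ n * r := by
    have := Nat.lt_floor_add_one (3 / r)
    rw [div_lt_iff₀ hrpos] at this
    rw [hn]; push_cast; linarith
  have hn4 : n * r ≤ 4 := by
    have := Nat.floor_le (show 0 ≤ 3 / r by positivity)
    rw [le_div_iff₀ hrpos] at this
    rw [hn]; push_cast; linarith
  have hnn₀ : n₀ ≤ n := by
    have h5 : s * (n₀ + 1) ≤ 1 := by rwa [le_div_iff₀ (by positivity)] at hsn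
    have h6 : (n₀ : ℝ) * s < n * s := by
      have : 3 ≤ (n : ℝ) * (4 / 3 * s) := hn3.trans (by gcongr)
      nlinarith
    exact_mod_cast (lt_of_mul_lt_mul_right h6 hs0.le).le
  obtain ⟨hRn, hlown⟩ := hn₀ n hnn₀
  set t := -Real.log (1 - s) with ht
  have hexpt : Real.exp (-t) = 1 - s := by rw [ht, neg_neg, Real.exp_log (by linarith)]
  have htpos : 0 < t := by rw [ht]; exact neg_pos.2 (Real.log_neg (by linarith) (by linarith))
  have ht2 : t ≤ 2 * s := by
    have h7 := Real.one_sub_inv_le_log_of_pos (show 0 < 1 - s by linarith)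
    have h8 : (1 - s)⁻¹ ≤ 1 + 2 * s := by
      rw [inv_le_iff_one_le_mul₀ (by linarith)]
      nlinarith
    rw [ht]; linarith
  -- Otherwise `log 2 / t > R a_n`, and the lower bound `exp (-32)` for a deviation of that size
  -- contradicts tightness.
  have hθt : θ₀ / a n ≤ t := by
    by_contra hlt
    rw [not_le, lt_div_iff₀ (ha n), hθ₀, lt_div_iff₀ hR] at hlt
    have h9 := le_measure_centredSum hν hs0 (by linarith) hn3 hn4
    refine absurd hRn (not_lt.2 (h9.trans ?_))
    refine measureReal_mono fun ξ hξ => ?_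
    refine le_trans (show _ ≤ -(Real.log 2 / t) from hξ) (neg_le_neg ?_)
    rw [le_div_iff₀ htpos]
    nlinarith
  have hup : 1 - Real.exp (-(b * θ₀ / a n)) ≤ 2 * b * s := by
    have h10 : b * θ₀ / a n ≤ b * t := by
      rw [mul_div_assoc]; gcongr
    have h11 := Real.add_one_le_exp (-(b * θ₀ / a n))
    nlinarith
  have hlow0 : 0 ≤ 1 - Real.exp (-(b * θ₀ / a n)) := by
    have : Real.exp (-(b * θ₀ / a n)) ≤ 1 :=
      Real.exp_le_one_iff.2 (neg_nonpos.2 (div_nonneg (by positivity) (ha n).le))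
    linarith
  have hmono := relExcess_mono hν hlow0 hup (by linarith)
  have hnpos : (0 : ℝ) < n := by rw [hn]; positivity
  have h12 : 32 * b ≤ n * relExcess ν (2 * b * s) :=
    hb.trans (hlown.le.trans (by gcongr))
  have h13 : 8 * b * r ≤ relExcess ν (2 * b * s) := by
    refine le_of_mul_le_mul_left ?_ hnpos
    calc n * (8 * b * r) = 8 * b * (n * r) := by ring
      _ ≤ 8 * b * 4 := by gcongr
      _ ≤ _ := by linarith
  have h14 : s * excess ν s ≤ r := by
    rw [hr, relExcess, le_div_iff₀ (by linarith)]
    nlinarith [mul_pos hs0 hg]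
  have hgb := excess_nonneg (ν := ν) (show 0 ≤ 2 * b * s by positivity) (by linarith)
  have h15 : relExcess ν (2 * b * s) ≤ 2 * (2 * b * s * excess ν (2 * b * s)) := by
    rw [relExcess, div_le_iff₀ (by linarith)]
    have h17 : 0 ≤ 2 * b * s * excess ν (2 * b * s) := by positivity
    have h18 := mul_le_mul_of_nonneg_left hsb' h17
    linarith
  -- Returning from `relExcess` to `excess` costs a factor `2` on the right and spends a factor `2
  -- b` on the ratio of the arguments, which leaves `2` of the factor `8 b`.
  have h16 : 4 * b * s * (2 * excess ν s) ≤ 4 * b * s * excess ν (2 * b * s) := by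
    calc 4 * b * s * (2 * excess ν s) = 8 * b * (s * excess ν s) := by ring
      _ ≤ 8 * b * r := by gcongr
      _ ≤ _ := h13.trans h15
      _ = _ := by ring
  exact le_of_mul_le_mul_left h16 (by positivity)

end StableDomain

/-! ## Decay of the survival probabilities -/

/-- A positive sequence with `p (n + 1) = p n * (1 - g (p n))`, where `g` grows at least like a
power near `0`, decays at most polynomially. -/
theorem exists_mul_le_of_recursion {p : ℕ → ℝ} {g : ℝ → ℝ} (hp0 : ∀ n, 0 < p n)
    (hp1 : ∀ n, p n ≤ 1) (hrec : ∀ n, p (n + 1) = p n * (1 - g (p n)))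
    (hg1 : ∀ s, 0 < s → s ≤ 1 → g s ≤ 1) (hgpos : ∀ s, 0 < s → s ≤ 1 → 0 < g s)
    (hgmono : ∀ s s', 0 < s → s ≤ s' → s' ≤ 1 → g s ≤ g s')
    (hgrow : ∃ b s₀ : ℝ, 1 < b ∧ 0 < s₀ ∧ ∀ s, 0 < s → s ≤ s₀ → b * s ≤ 1 ∧ 2 * g s ≤ g (b * s)) :
    Antitone p ∧ Tendsto p atTop (𝓝 0) ∧ ∃ κ : ℝ, 0 < κ ∧ κ ≤ 1 ∧ ∀ᶠ n : ℕ in atTop,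
      ∀ k ≤ 4 * n, κ * p n ≤ p (n + k) := by
  have hanti : Antitone p := antitone_nat_of_succ_le fun n => by
    rw [hrec]
    have := mul_pos (hp0 n) (hgpos _ (hp0 n) (hp1 n))
    linarith
  -- By monotonicity, each of the `k` decrements is at least the one at time `m + k`.
  have hdrop : ∀ m k, p (m + k) + k * (p (m + k) * g (p (m + k))) ≤ p m := by
    intro m k
    have h : ∀ i ≤ k, p (m + i) + i * (p (m + k) * g (p (m + k))) ≤ p m := by
      intro i
      induction i with
      | zero => simp
      | succ i ih =>
        intro hi
        have h1 := ih (by omega)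
        have hle : p (m + k) ≤ p (m + i) := hanti (by omega)
        have h2 : p (m + k) * g (p (m + k)) ≤ p (m + i) * g (p (m + i)) :=
          mul_le_mul hle (hgmono _ _ (hp0 _) hle (hp1 _)) (hgpos _ (hp0 _) (hp1 _)).le (hp0 _).le
        rw [← add_assoc, hrec]
        push_cast
        linarith
    exact h k le_rfl
  have hlim : Tendsto p atTop (𝓝 0) := by
    have hbdd : BddBelow (Set.range p) := ⟨0, by rintro _ ⟨n, rfl⟩; exact (hp0 n).le⟩
    have hinf := tendsto_atTop_ciInf hanti hbdd
    set q := ⨅ n, p n with hq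
    have hq0 : 0 ≤ q := le_ciInf fun n => (hp0 n).le
    rcases hq0.eq_or_lt with h | h
    · rwa [← h] at hinf
    · exfalso
      have hqle : ∀ n, q ≤ p n := fun n => ciInf_le hbdd n
      have hq1 : q ≤ 1 := (hqle 0).trans (hp1 0)
      have hgq := mul_pos h (hgpos q h hq1)
      obtain ⟨k, hk⟩ := exists_nat_gt (1 / (q * g q))
      rw [div_lt_iff₀ hgq] at hk
      have h1 := hdrop 0 k
      rw [zero_add] at h1
      have h2 : q * g q ≤ p k * g (p k) :=
        mul_le_mul (hqle k) (hgmono _ _ h (hqle k) (hp1 k)) (hgpos q h hq1).le (hp0 k).le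
      have h3 : (k : ℝ) * (q * g q) ≤ k * (p k * g (p k)) := by gcongr
      linarith [hp0 k, hp1 0]
  obtain ⟨b, s₀, hb, hs₀, hgr⟩ := hgrow
  obtain ⟨N₁, hN₁⟩ := eventually_atTop.1 (hlim.eventually_lt_const hs₀)
  set C : ℝ := max (2 * N₁ + 2) (2 * b ^ 2) with hC
  have hCpos : 0 < C := lt_of_lt_of_le (by positivity) (le_max_left _ _)
  -- Suppose `n g(p_n) > C` with `C ≥ 2 b²`. The drop over the second half of `[0, n]` gives `p_m ≥
  -- b² p_n` for `m = n / 2`, so `g(p_m) ≥ 4 g(p_n)` by two growth steps. With `m ≥ n/3`, this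
  -- contradicts the bound already known at `m`. The other term of `C` covers the small `n`.
  have hbound : ∀ n : ℕ, n * g (p n) ≤ C := by
    intro n
    induction n using Nat.strong_induction_on with
    | _ n ih =>
    rcases Nat.lt_or_ge n (2 * N₁ + 2) with hn | hn
    · calc n * g (p n) ≤ n * 1 := by gcongr; exact hg1 _ (hp0 n) (hp1 n)
        _ ≤ 2 * N₁ + 2 := by rw [mul_one]; exact_mod_cast hn.le
        _ ≤ C := le_max_left _ _
    · by_contra hlt
      rw [not_le] at hlt
      set m := n / 2 with hm
      have hmn : m + (n - m) = n := by omega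
      have hd := hdrop m (n - m)
      rw [hmn] at hd
      have hnm : (n : ℝ) / 2 ≤ ((n - m : ℕ) : ℝ) := by
        rw [div_le_iff₀ (by norm_num)]
        exact_mod_cast (by omega : n ≤ (n - m) * 2)
      have hm3 : (n : ℝ) / 3 ≤ m := by
        rw [div_le_iff₀ (by norm_num)]
        exact_mod_cast (by omega : n ≤ m * 3)
      have hpg := mul_pos (hp0 n) (hgpos _ (hp0 n) (hp1 n))
      have hbp : b * (b * p n) ≤ p m := by
        have h1 : (n : ℝ) / 2 * (p n * g (p n)) ≤ ((n - m : ℕ) : ℝ) * (p n * g (p n)) := by gcongr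
        have h2 : 2 * b ^ 2 * p n ≤ n * g (p n) * p n :=
          mul_le_mul_of_nonneg_right ((le_max_right _ _).trans hlt.le) (hp0 n).le
        nlinarith [hp0 n]
      have hms := (hN₁ m (by omega)).le
      have hb1 : b * p n ≤ s₀ := by nlinarith [mul_pos (zero_lt_one.trans hb) (hp0 n)]
      have hb0 : p n ≤ s₀ := by nlinarith [hp0 n]
      have hbpos : 0 < b * p n := mul_pos (by linarith) (hp0 n)
      have h3 := (hgr _ (hp0 n) hb0).2
      have h4 := (hgr _ hbpos hb1).2
      have h5 := hgmono _ _ (mul_pos (by linarith) hbpos) hbp (hp1 m)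
      have h6 := ih m (by omega)
      have h7 : (n : ℝ) / 3 * (4 * g (p n)) ≤ m * g (p m) := by
        refine mul_le_mul hm3 (by linarith) ?_ (Nat.cast_nonneg _)
        linarith [hgpos _ (hp0 n) (hp1 n)]
      linarith
  refine ⟨hanti, hlim, Real.exp (-(8 * C)), Real.exp_pos _,
    Real.exp_le_one_iff.2 (by linarith), ?_⟩
  filter_upwards [eventually_ge_atTop ⌈2 * C⌉₊] with n hn k hk
  have hn' : 2 * C ≤ n := (Nat.le_ceil _).trans (by exact_mod_cast hn)
  have hnpos : (0 : ℝ) < n := by linarith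
  set x := g (p n) with hx
  have hx0 : 0 < x := hgpos _ (hp0 n) (hp1 n)
  have hnx : n * x ≤ C := hbound n
  have hx2 : x ≤ 1 / 2 := by
    refine le_of_mul_le_mul_left ?_ hnpos
    linarith
  have hexp : Real.exp (-(2 * x)) ≤ 1 - x := by
    rw [← Real.le_log_iff_exp_le (by linarith)]
    have h1 := Real.one_sub_inv_le_log_of_pos (show 0 < 1 - x by linarith)
    have h2 : (1 - x)⁻¹ ≤ 1 + 2 * x := by
      rw [inv_le_iff_one_le_mul₀ (by linarith)]
      nlinarith
    linarith
  -- After time `n` each factor `1 - g` is at least `1 - x ≥ exp (-2 x)`. Over `4 n` steps the loss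
  -- is at most `exp (-8 n x)`, and `n x ≤ C`.
  have hpow : ∀ k, p n * Real.exp (-(2 * x)) ^ k ≤ p (n + k) := by
    intro k
    induction k with
    | zero => simp
    | succ k ih =>
      rw [pow_succ, ← mul_assoc, ← add_assoc, hrec]
      have h1 : g (p (n + k)) ≤ x := hgmono _ _ (hp0 _) (hanti (by omega)) (hp1 _)
      exact mul_le_mul ih (by linarith) (Real.exp_pos _).le (hp0 _).le
  refine le_trans ?_ (hpow k)
  rw [mul_comm, ← Real.exp_nat_mul]
  refine mul_le_mul_of_nonneg_left (Real.exp_le_exp.2 ?_) (hp0 n).le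
  have hk' : (k : ℝ) ≤ 4 * n := by exact_mod_cast hk
  nlinarith

/-! ### The recursion for the survival probabilities -/

section Survival

variable {ν : PMF ℕ}

theorem survivalProb_eq (ν : PMF ℕ) (n : ℕ) :
    survivalProb ν n = (gwLaw ν).real {t | 0 < t.genSize n} := rfl

theorem measurableSet_genSize_pos (n : ℕ) : MeasurableSet {t : FamilyTree | 0 < t.genSize n} :=
  measurableSet_lt measurable_const (measurable_genSize n)

theorem survivalProb_nonneg (ν : PMF ℕ) (n : ℕ) : 0 ≤ survivalProb ν n := measureReal_nonneg

theorem survivalProb_le_one (ν : PMF ℕ) (n : ℕ) : survivalProb ν n ≤ 1 := measureReal_le_one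

theorem extinct_eq (ν : PMF ℕ) (n : ℕ) :
    gwLaw ν {t | t.genSize n = 0} = ENNReal.ofReal (1 - survivalProb ν n) := by
  have h : {t : FamilyTree | t.genSize n = 0} = {t | 0 < t.genSize n}ᶜ := by
    ext t; simp
  rw [h, survivalProb_eq, ← probReal_compl_eq_one_sub (measurableSet_genSize_pos n), ofReal_measureReal]

/-- Conditioning on the first generation gives `1 - p_{n+1} = f(1 - p_n)`, and the excess is the
correction to `f(1 - s) ≈ 1 - s`. -/
theorem survivalProb_succ (hν : IsCritical ν) (n : ℕ) :
    survivalProb ν (n + 1) = survivalProb ν n * (1 - excess ν (survivalProb ν n)) := by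
  set q := survivalProb ν n with hq
  have hq0 : 0 ≤ q := survivalProb_nonneg ν n
  have hq1 : q ≤ 1 := survivalProb_le_one ν n
  have h := gwLaw_genSize_add_eq_zero ν 1 n
  have h1 : ∫⁻ t, gwLaw ν {t | t.genSize n = 0} ^ t.genSize 1 ∂(gwLaw ν) =
      ENNReal.ofReal (1 - q + q * excess ν q) := by
    rw [← lintegral_map (f := fun k : ℕ => gwLaw ν {t | t.genSize n = 0} ^ k) Measurable.of_discrete
      (measurable_genSize 1), map_genSize_one, ← integral_one_sub_pow hν hq0 hq1,
      ofReal_integral_eq_lintegral_ofReal]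
    · refine lintegral_congr fun k => ?_
      rw [extinct_eq, ENNReal.ofReal_pow (by linarith)]
    · refine Integrable.of_bound Measurable.of_discrete.aestronglyMeasurable 1
        (ae_of_all _ fun k => ?_)
      rw [Real.norm_of_nonneg (pow_nonneg (by linarith) k)]
      exact pow_le_one₀ (by linarith) (by linarith)
    · exact ae_of_all _ fun k => pow_nonneg (by linarith) k
  rw [h1, extinct_eq, add_comm 1 n] at h
  have hg := excess_nonneg (ν := ν) hq0 hq1
  have h2 := (ENNReal.ofReal_eq_ofReal_iff (sub_nonneg.2 (survivalProb_le_one ν (n + 1)))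
    (by nlinarith [mul_nonneg hq0 hg])).1 h
  linarith

theorem survivalProb_zero (ν : PMF ℕ) : survivalProb ν 0 = 1 := by
  have h : {t : FamilyTree | 0 < t.genSize 0} = Set.univ := by
    refine Set.eq_univ_of_forall fun t => ?_
    exact (Set.ncard_pos (t.finite_level 0)).2 ⟨[], t.root_mem, rfl⟩
  rw [survivalProb_eq, h, probReal_univ]

/-- Some `k ≥ 1` has positive mass, and there `powExcess k s < k` because its term `j = 0` vanishes.
This keeps all survival probabilities positive. -/
theorem excess_lt_one (hν : IsCritical ν) {s : ℝ} (h0 : 0 ≤ s) (h1 : s ≤ 1) : excess ν s < 1 := by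
  have hex : ∃ k : ℕ, 1 ≤ k ∧ 0 < (ν k).toReal := by
    by_contra! hcon
    have h2 : ∀ k : ℕ, (ν k).toReal * k = 0 := fun k => by
      rcases Nat.eq_zero_or_pos k with rfl | hk
      · simp
      · rw [le_antisymm (hcon k hk) ENNReal.toReal_nonneg, zero_mul]
    have h3 := hν.hasSum_mean.tsum_eq
    simp [h2] at h3
  obtain ⟨k, hk, hνk⟩ := hex
  rw [← hν.hasSum_mean.tsum_eq]
  refine Summable.tsum_lt_tsum (i := k)
    (fun k => mul_le_mul_of_nonneg_left (powExcess_le k h1) ENNReal.toReal_nonneg) ?_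
    (summable_excess hν h0 h1) hν.hasSum_mean.summable
  refine mul_lt_mul_of_pos_left ?_ hνk
  calc powExcess k s < ∑ _ ∈ Finset.range k, (1 : ℝ) := by
        refine Finset.sum_lt_sum (fun j _ => sub_le_self _ (pow_nonneg (by linarith) j))
          ⟨0, Finset.mem_range.2 hk, by simp⟩
    _ = k := by simp

theorem survivalProb_pos (hν : IsCritical ν) (n : ℕ) : 0 < survivalProb ν n := by
  induction n with
  | zero => rw [survivalProb_zero]; exact one_pos
  | succ n ih =>
    rw [survivalProb_succ hν]
    exact mul_pos ih (sub_pos.2 (excess_lt_one hν ih.le (survivalProb_le_one ν n)))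

theorem InStableDomain.survivalProb_regular {α : ℝ} (hα : 1 < α) (hν : IsCritical ν)
    (h : InStableDomain α ν) :
    Antitone (survivalProb ν) ∧ Tendsto (survivalProb ν) atTop (𝓝 0) ∧
    ∃ κ : ℝ, 0 < κ ∧ κ ≤ 1 ∧ ∀ᶠ n : ℕ in atTop,
      ∀ k ≤ 4 * n, κ * survivalProb ν n ≤ survivalProb ν (n + k) :=
  exists_mul_le_of_recursion (g := excess ν) (survivalProb_pos hν) (survivalProb_le_one ν)
    (survivalProb_succ hν) (fun _ h0 h1 => excess_le_one hν h0.le h1)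
    (fun _ h0 h1 => h.excess_pos hα hν h0 h1) (fun _ _ h0 hs h1 => excess_mono hν h0.le hs h1)
    (h.excess_growth hα hν)

end Survival

/-! ## Large generations and large volumes of a Galton–Watson tree -/

namespace FamilyTree

theorem genSize_pos_of_le (t : FamilyTree) {m n : ℕ} (hmn : m ≤ n) (h : 0 < t.genSize n) :
    0 < t.genSize m := by
  obtain ⟨u, hu, hl⟩ := (Set.ncard_pos (t.finite_level n)).1 h
  refine (Set.ncard_pos (t.finite_level m)).2 ⟨ancestor u m, ?_, ancestor_length (by omega)⟩
  exact t.mem_of_suffix (ancestor_suffix u m) hu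

theorem sum_genSize_le (t : FamilyTree) {m k N : ℕ} (h : m + k ≤ N + 1) :
    ∑ j ∈ Finset.range k, t.genSize (m + j) ≤ (t.upToFinset N).card := by
  classical
  have h1 : ∀ j ∈ Finset.range k, t.genSize (m + j) =
      ((t.upToFinset N).filter fun u => u.length = m + j).card := fun j hj =>
    t.genSize_eq_countLength (by have := Finset.mem_range.1 hj; omega)
  rw [Finset.sum_congr rfl h1, ← Finset.card_biUnion]
  · exact Finset.card_le_card (Finset.biUnion_subset.2 fun j _ => Finset.filter_subset _ _)
  · intro i _ j _ hij
    refine Finset.disjoint_left.2 fun u hu hu' => hij ?_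
    have := (Finset.mem_filter.1 hu).2
    have := (Finset.mem_filter.1 hu').2
    omega

end FamilyTree

section LargeTrees

variable {ν : PMF ℕ}

/-- Write `1 - p_{2n} = E (1 - p_n)^{Z_n}`. Where `0 < Z_n < c / p_n` the integrand is at least `1 -
c`, so these trees account for at most `c p_n` of `p_{2n} ≥ 2 c p_n`; the remainder comes from large
`Z_n`. -/
theorem le_measure_genSize (hν : IsCritical ν) {c : ℝ} (hc : 0 < c) {n : ℕ}
    (h : 2 * c * survivalProb ν n ≤ survivalProb ν (n + n)) :
    c * survivalProb ν n ≤ (gwLaw ν).real {t | c / survivalProb ν n ≤ t.genSize n} := by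
  set p := survivalProb ν n with hp
  have hp0 : 0 < p := survivalProb_pos hν n
  have hp1 : p ≤ 1 := survivalProb_le_one ν n
  set A := {t : FamilyTree | c / p ≤ t.genSize n} with hA
  set B := {t : FamilyTree | 0 < t.genSize n} with hB
  have hAm : MeasurableSet A := measurableSet_le measurable_const
    ((Measurable.of_discrete (f := fun k : ℕ => (k : ℝ))).comp (measurable_genSize n))
  have hBm : MeasurableSet B := measurableSet_genSize_pos n
  have hint : Integrable (fun t : FamilyTree => (1 - p) ^ t.genSize n) (gwLaw ν) := by
    refine Integrable.of_bound (((Measurable.of_discrete (f := fun k : ℕ => (1 - p) ^ k)).comp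
      (measurable_genSize n)).aestronglyMeasurable) 1 (ae_of_all _ fun t => ?_)
    rw [Real.norm_of_nonneg (pow_nonneg (by linarith) _)]
    exact pow_le_one₀ (by linarith) (by linarith)
  have hext : 1 - survivalProb ν (n + n) = ∫ t, (1 - p) ^ t.genSize n ∂(gwLaw ν) := by
    have h1 := gwLaw_genSize_add_eq_zero ν n n
    simp only [extinct_eq] at h1
    have h2 : ∫⁻ t, ENNReal.ofReal (1 - p) ^ t.genSize n ∂(gwLaw ν) =
        ENNReal.ofReal (∫ t, (1 - p) ^ t.genSize n ∂(gwLaw ν)) := by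
      rw [ofReal_integral_eq_lintegral_ofReal hint
        (ae_of_all _ fun t => pow_nonneg (by linarith) _)]
      exact lintegral_congr fun t => (ENNReal.ofReal_pow (by linarith) _).symm
    rw [h2] at h1
    exact (ENNReal.ofReal_eq_ofReal_iff (sub_nonneg.2 (survivalProb_le_one ν _))
      (integral_nonneg fun t => pow_nonneg (by linarith) _)).1 h1
  have hpt : ∀ t, 1 - A.indicator (fun _ => (1 : ℝ)) t - B.indicator (fun _ => c) t ≤
      (1 - p) ^ t.genSize n := by
    intro t
    have hpow : 0 ≤ (1 - p) ^ t.genSize n := pow_nonneg (by linarith) _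
    have hBc : 0 ≤ B.indicator (fun _ => c) t := Set.indicator_nonneg (fun _ _ => hc.le) t
    by_cases htA : t ∈ A
    · rw [Set.indicator_of_mem htA]; linarith
    · rw [Set.indicator_of_notMem htA]
      by_cases htB : t ∈ B
      · rw [Set.indicator_of_mem htB]
        have h3 : (t.genSize n : ℝ) < c / p := not_le.1 htA
        rw [lt_div_iff₀ hp0] at h3
        have h4 := one_add_mul_le_pow (a := -p) (by linarith) (t.genSize n)
        rw [← sub_eq_add_neg 1 p] at h4
        linarith
      · have h5 : t.genSize n = 0 := Nat.eq_zero_of_not_pos htB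
        rw [h5, pow_zero]; linarith
  have hA1 : Integrable (A.indicator fun _ => (1 : ℝ)) (gwLaw ν) :=
    (integrable_const _).indicator hAm
  have hB1 : Integrable (B.indicator fun _ => c) (gwLaw ν) := (integrable_const _).indicator hBm
  have h6 := integral_mono (((integrable_const (1 : ℝ)).sub hA1).sub hB1) hint hpt
  have h7 : ∫ t, (1 - A.indicator (fun _ => (1 : ℝ)) t - B.indicator (fun _ => c) t) ∂(gwLaw ν) =
      1 - (gwLaw ν).real A - c * p := by
    have hAB : Integrable (fun t => 1 - A.indicator (fun _ => (1 : ℝ)) t) (gwLaw ν) :=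
      (integrable_const (1 : ℝ)).sub hA1
    rw [integral_sub hAB hB1, integral_sub (integrable_const _) hA1, integral_indicator_const _ hAm,
      integral_indicator_const _ hBm, hp, survivalProb_eq]
    simp [mul_comm, hB]
  have h8 : 1 - (gwLaw ν).real A - c * p ≤ 1 - survivalProb ν (n + n) := by
    rw [hext, ← h7]; exact h6
  linarith

/-- A reverse Markov inequality for the number `V` of large generations among `m, …, 2 m - 1`. Its
mean is at least `m c κ p`, it is at most `m`, and it vanishes unless the tree survives to
generation `m`, so trees with `V < c κ m / 2` carry at most half of the mean. -/
theorem le_measure_volume (hν : IsCritical ν) {c κ : ℝ} (hc : 0 < c) (hκ : 0 < κ) {m : ℕ}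
    (hm : 0 < m) (hanti : Antitone (survivalProb ν))
    (hlev : ∀ j, m ≤ j → c * survivalProb ν j ≤
      (gwLaw ν).real {t | c / survivalProb ν j ≤ t.genSize j})
    (hreg : ∀ j ≤ m, κ * survivalProb ν m ≤ survivalProb ν (m + j)) :
    c * κ / 2 * survivalProb ν m ≤ (gwLaw ν).real
      {t | c * κ / 2 * m * (c / survivalProb ν m) ≤
        ∑ j ∈ Finset.range (2 * m), (t.genSize j : ℝ)} := by
  set p := survivalProb ν m with hp
  have hp0 : 0 < p := survivalProb_pos hν m
  have hmpos : (0 : ℝ) < m := by exact_mod_cast hm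
  set A : ℕ → Set FamilyTree := fun j => {t | c / p ≤ t.genSize (m + j)} with hA
  have hZm : ∀ j, Measurable fun t : FamilyTree => (t.genSize j : ℝ) := fun j =>
    (Measurable.of_discrete (f := fun k : ℕ => (k : ℝ))).comp (measurable_genSize j)
  have hAm : ∀ j, MeasurableSet (A j) := fun j => measurableSet_le measurable_const (hZm _)
  have hAge : ∀ j ∈ Finset.range m, c * κ * p ≤ (gwLaw ν).real (A j) := by
    intro j hj
    have hjm := Finset.mem_range.1 hj
    calc c * κ * p = c * (κ * p) := mul_assoc _ _ _
      _ ≤ c * survivalProb ν (m + j) := by gcongr; exact hreg j hjm.le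
      _ ≤ _ := hlev (m + j) (by omega)
      _ ≤ _ := by
        refine measureReal_mono fun t ht => ?_
        change c / p ≤ t.genSize (m + j)
        refine le_trans ?_ (show _ ≤ _ from ht)
        have := survivalProb_pos hν (m + j)
        have := hanti (show m ≤ m + j by omega)
        gcongr
  set V : FamilyTree → ℝ := fun t => ∑ j ∈ Finset.range m, (A j).indicator (fun _ => (1 : ℝ)) t
    with hV
  have hVm : Measurable V :=
    Finset.measurable_sum _ fun j _ => measurable_const.indicator (hAm j)
  set E := {t : FamilyTree | c * κ / 2 * m ≤ V t} with hE
  have hEm : MeasurableSet E := measurableSet_le measurable_const hVm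
  set B := {t : FamilyTree | 0 < t.genSize m} with hB
  have hBm : MeasurableSet B := measurableSet_genSize_pos m
  have hpt : ∀ t, V t ≤ E.indicator (fun _ => (m : ℝ)) t +
      B.indicator (fun _ => c * κ / 2 * m) t := by
    intro t
    have hE0 : 0 ≤ E.indicator (fun _ => (m : ℝ)) t :=
      Set.indicator_nonneg (fun _ _ => hmpos.le) t
    have hB0 : 0 ≤ B.indicator (fun _ => c * κ / 2 * m) t :=
      Set.indicator_nonneg (fun _ _ => by positivity) t
    by_cases htE : t ∈ E
    · have : V t ≤ m := by
        calc V t ≤ ∑ _ ∈ Finset.range m, (1 : ℝ) :=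
              Finset.sum_le_sum fun j _ => Set.indicator_le_self' (fun _ _ => zero_le_one) t
          _ = m := by simp
      rw [Set.indicator_of_mem htE]; linarith
    · by_cases htB : t ∈ B
      · have : V t < c * κ / 2 * m := not_le.1 htE
        rw [Set.indicator_of_mem htB]; linarith
      · have : V t = 0 := Finset.sum_eq_zero fun j _ => by
          refine Set.indicator_of_notMem (fun htA => htB ?_) _
          have htA' : c / p ≤ t.genSize (m + j) := htA
          have h1 : (0 : ℝ) < t.genSize (m + j) := (div_pos hc hp0).trans_le htA'
          exact t.genSize_pos_of_le (Nat.le_add_right m j) (by exact_mod_cast h1)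
        linarith
  have hVi : ∀ j ∈ Finset.range m, Integrable ((A j).indicator fun _ => (1 : ℝ)) (gwLaw ν) :=
    fun j _ => (integrable_const _).indicator (hAm j)
  have hEi : Integrable (E.indicator fun _ => (m : ℝ)) (gwLaw ν) :=
    (integrable_const _).indicator hEm
  have hBi : Integrable (B.indicator fun _ => c * κ / 2 * m) (gwLaw ν) :=
    (integrable_const _).indicator hBm
  have h2 : ∫ t, V t ∂(gwLaw ν) = ∑ j ∈ Finset.range m, (gwLaw ν).real (A j) := by
    rw [hV, integral_finsetSum _ hVi]
    refine Finset.sum_congr rfl fun j _ => ?_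
    rw [integral_indicator_const _ (hAm j)]; simp
  have h3 : m * (c * κ * p) ≤ ∫ t, V t ∂(gwLaw ν) := by
    rw [h2]
    simpa using Finset.card_nsmul_le_sum _ _ _ hAge
  have h4 := integral_mono (integrable_finsetSum _ hVi) (hEi.add hBi) hpt
  have h5 : ∫ t, (E.indicator (fun _ => (m : ℝ)) t +
      B.indicator (fun _ => c * κ / 2 * m) t) ∂(gwLaw ν) =
      m * (gwLaw ν).real E + c * κ / 2 * m * p := by
    rw [integral_add hEi hBi, integral_indicator_const _ hEm, integral_indicator_const _ hBm, hp,
      survivalProb_eq]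
    simp [mul_comm, hB]
  have h6 : m * (c * κ * p) ≤ m * ((gwLaw ν).real E + c * κ / 2 * p) := by
    calc _ ≤ _ := h3
      _ ≤ _ := h4
      _ = m * (gwLaw ν).real E + c * κ / 2 * m * p := h5
      _ = _ := by ring
  have h7 : c * κ / 2 * p ≤ (gwLaw ν).real E := by
    have := le_of_mul_le_mul_left h6 hmpos
    linarith
  refine h7.trans (measureReal_mono fun t ht => ?_)
  have ht' : c * κ / 2 * m ≤ V t := ht
  calc c * κ / 2 * m * (c / p) ≤ V t * (c / p) := by gcongr
    _ = ∑ j ∈ Finset.range m, (A j).indicator (fun _ => (1 : ℝ)) t * (c / p) := Finset.sum_mul _ _ _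
    _ ≤ ∑ j ∈ Finset.range m, (t.genSize (m + j) : ℝ) := by
        refine Finset.sum_le_sum fun j _ => ?_
        by_cases htA : t ∈ A j
        · rw [Set.indicator_of_mem htA, one_mul]; exact htA
        · rw [Set.indicator_of_notMem htA, zero_mul]; positivity
    _ ≤ ∑ j ∈ Finset.range (2 * m), (t.genSize j : ℝ) := by
        rw [two_mul, Finset.sum_range_add]
        exact le_add_of_nonneg_left (Finset.sum_nonneg fun j _ => Nat.cast_nonneg _)

end LargeTrees

/-! ## Many large subtrees -/

section Blocks

variable {μ : Measure (ℕ → ℕ)} [IsProbabilityMeasure μ]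

/-- An increasing event of probability at least `q` for one of `B` independent summands. -/
theorem le_convPow_of_increasing {A : Set (ℕ → ℕ)} (hA : MeasurableSet A)
    (hinc : ∀ x y, x ∈ A → x + y ∈ A) {q : ℝ} (hqA : q ≤ μ.real A) (B : ℕ) :
    ENNReal.ofReal (1 - Real.exp (-(q * B))) ≤ convPow μ B A := by
  have h1 : convPow μ B Aᶜ ≤ μ Aᶜ ^ B := by
    refine convPow_apply_le_pow μ hA.compl (fun x y h => ⟨fun hx => h (hinc x y hx), fun hy => ?_⟩) B
    rw [add_comm] at h
    exact h (hinc y x hy)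
  have h2 : (convPow μ B).real Aᶜ ≤ Real.exp (-(q * B)) := by
    calc (convPow μ B).real Aᶜ ≤ (μ Aᶜ ^ B).toReal := ENNReal.toReal_mono (by finiteness) h1
      _ = (1 - μ.real A) ^ B := by
          rw [ENNReal.toReal_pow, ← measureReal_def, probReal_compl_eq_one_sub hA]
      _ ≤ Real.exp (-q) ^ B := by
          refine pow_le_pow_left₀ (sub_nonneg.2 measureReal_le_one) ?_ B
          linarith [Real.add_one_le_exp (-q)]
      _ = Real.exp (-(q * B)) := by rw [← Real.exp_nat_mul]; congr 1; ring
  rw [probReal_compl_eq_one_sub hA] at h2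
  rw [← ofReal_measureReal]
  exact ENNReal.ofReal_le_ofReal (by linarith)

theorem measurable_sum_range (k : ℕ) :
    Measurable fun x : ℕ → ℕ => ∑ j ∈ Finset.range k, (x j : ℝ) :=
  Finset.measurable_sum _ fun j _ =>
    (Measurable.of_discrete (f := fun k : ℕ => (k : ℝ))).comp (measurable_pi_apply j)

/-- The `K` blocks of `B` trees are independent, and their volumes add. -/
theorem pow_le_convPow_sum {k B : ℕ} {a : ℝ} {d : ℝ≥0∞}
    (hd : d ≤ convPow μ B {x | a ≤ ∑ j ∈ Finset.range k, (x j : ℝ)}) (K : ℕ) :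
    d ^ K ≤ convPow μ (K * B) {x | K * a ≤ ∑ j ∈ Finset.range k, (x j : ℝ)} := by
  induction K with
  | zero =>
    have h : {x : ℕ → ℕ | ((0 : ℕ) : ℝ) * a ≤ ∑ j ∈ Finset.range k, (x j : ℝ)} = Set.univ :=
      Set.eq_univ_of_forall fun x => by
        change ((0 : ℕ) : ℝ) * a ≤ _
        rw [Nat.cast_zero, zero_mul]
        exact Finset.sum_nonneg fun j _ => Nat.cast_nonneg _
    rw [h]; simp
  | succ K ih =>
    rw [pow_succ, Nat.succ_mul, convPow_add]
    refine le_trans (by gcongr) (conv_apply_ge _ _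
      (measurableSet_le measurable_const (measurable_sum_range k)) fun x hx y hy => ?_)
    have hx' : K * a ≤ ∑ j ∈ Finset.range k, (x j : ℝ) := hx
    have hy' : a ≤ ∑ j ∈ Finset.range k, (y j : ℝ) := hy
    change ((K + 1 : ℕ) : ℝ) * a ≤ ∑ j ∈ Finset.range k, (((x + y) j : ℕ) : ℝ)
    simp only [Pi.add_apply, Nat.cast_add, Finset.sum_add_distrib]
    push_cast
    linarith

/-- `K` blocks supply the volume and one further block populates generation `l`. The remaining `n -
(K + 1) * B` trees can only help. -/
theorem pow_le_convPow_sum_and {k B l : ℕ} {a b : ℝ} {d : ℝ≥0∞}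
    (hd : d ≤ convPow μ B {x | a ≤ ∑ j ∈ Finset.range k, (x j : ℝ)})
    (hd' : d ≤ convPow μ B {x | b ≤ (x l : ℝ)}) (K : ℕ) {n : ℕ} (hn : (K + 1) * B ≤ n) :
    d ^ (K + 1) ≤
      convPow μ n {x | K * a ≤ ∑ j ∈ Finset.range k, (x j : ℝ) ∧ b ≤ (x l : ℝ)} := by
  obtain ⟨r, rfl⟩ := Nat.exists_eq_add_of_le hn
  have hm : MeasurableSet
      {x : ℕ → ℕ | K * a ≤ ∑ j ∈ Finset.range k, (x j : ℝ) ∧ b ≤ (x l : ℝ)} :=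
    (measurableSet_le measurable_const (measurable_sum_range k)).inter
      (measurableSet_le measurable_const
        ((Measurable.of_discrete (f := fun k : ℕ => (k : ℝ))).comp (measurable_pi_apply l)))
  rw [convPow_add, Nat.succ_mul, convPow_add]
  have h1 := conv_apply_ge (convPow μ (K * B)) (convPow μ B) hm
    (A := {x | K * a ≤ ∑ j ∈ Finset.range k, (x j : ℝ)}) (B := {x | b ≤ (x l : ℝ)})
    (fun x hx y hy => ⟨?_, ?_⟩)
  · have h2 := conv_apply_ge ((convPow μ (K * B)).conv (convPow μ B)) (convPow μ r) hm
      (A := {x | K * a ≤ ∑ j ∈ Finset.range k, (x j : ℝ) ∧ b ≤ (x l : ℝ)}) (B := Set.univ)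
      (fun x hx y _ => ⟨?_, ?_⟩)
    · rw [measure_univ, mul_one] at h2
      refine le_trans ?_ h2
      refine le_trans ?_ h1
      rw [pow_succ]
      gcongr
      exact pow_le_convPow_sum hd K
    · refine hx.1.trans (Finset.sum_le_sum fun j _ => ?_)
      simp
    · refine hx.2.trans ?_
      simp
  · refine le_trans (show _ ≤ _ from hx) (Finset.sum_le_sum fun j _ => ?_)
    simp
  · refine le_trans (show _ ≤ _ from hy) ?_
    simp

end Blocks

/-! ### Large volume at a cost comparable to survival, and size-biasing -/

section LargeTrees

variable {ν : PMF ℕ} {α : ℝ}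

/-- With probability comparable to that of survival, both the volume of the first `m` generations
and the size of generation `m` are at least of their typical order given survival, at scale `m`. -/
theorem InStableDomain.exists_large (hα : 1 < α) (hν : IsCritical ν) (h : InStableDomain α ν) :
    ∃ κ η : ℝ, 0 < κ ∧ 0 < η ∧ ∀ᶠ m : ℕ in atTop,
      (∀ j ≤ 4 * m, κ * survivalProb ν m ≤ survivalProb ν (m + j)) ∧
      (∀ j ≤ m, η * survivalProb ν m ≤
        (gwLaw ν).real {t | η / survivalProb ν m ≤ t.genSize (m + j)}) ∧
      η * survivalProb ν m ≤ (gwLaw ν).real {t | η * m / survivalProb ν m ≤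
        ∑ j ∈ Finset.range (2 * m), (t.genSize j : ℝ)} := by
  obtain ⟨hanti, -, κ, hκ, hκ1, hreg⟩ := h.survivalProb_regular hα hν
  set c := κ / 2 with hc
  have hcpos : 0 < c := by positivity
  have hc1 : c ≤ 1 / 2 := by rw [hc]; linarith
  obtain ⟨n₀, hn₀⟩ := eventually_atTop.1 hreg
  have hlev : ∀ j, n₀ ≤ j → c * survivalProb ν j ≤
      (gwLaw ν).real {t | c / survivalProb ν j ≤ t.genSize j} := fun j hj =>
    le_measure_genSize hν hcpos (by
      have := hn₀ j hj j (by omega)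
      rw [hc]; linarith)
  -- Small enough to serve as both threshold and probability, in the generation bound as well as in
  -- the volume bound.
  set η := c * κ / 2 * c with hη
  have hηpos : 0 < η := by positivity
  have hη1 : η ≤ c * κ / 2 := mul_le_of_le_one_right (by positivity) (by linarith)
  have hη2 : η ≤ c := mul_le_of_le_one_left hcpos.le (by nlinarith)
  refine ⟨κ, η, hκ, hηpos, ?_⟩
  filter_upwards [eventually_ge_atTop n₀, eventually_gt_atTop 0] with m hm hm0
  have hp0 := survivalProb_pos hν m
  refine ⟨hn₀ m hm, fun j hj => ?_, ?_⟩
  · have hpj := survivalProb_pos hν (m + j)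
    have hpanti := hanti (show m ≤ m + j by omega)
    calc η * survivalProb ν m ≤ c * κ * survivalProb ν m := by
          gcongr
          nlinarith [mul_pos hcpos hκ]
      _ = c * (κ * survivalProb ν m) := mul_assoc _ _ _
      _ ≤ c * survivalProb ν (m + j) := by gcongr; exact hn₀ m hm j (by omega)
      _ ≤ _ := hlev (m + j) (by omega)
      _ ≤ _ := by
        refine measureReal_mono fun t ht => ?_
        change η / survivalProb ν m ≤ t.genSize (m + j)
        refine le_trans ?_ (show _ ≤ _ from ht)
        gcongr
  · have hv := le_measure_volume hν hcpos hκ hm0 hanti (fun j hj => hlev j (by omega))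
      (fun j hj => hn₀ m hm j (by omega))
    calc η * survivalProb ν m ≤ c * κ / 2 * survivalProb ν m := by gcongr
      _ ≤ _ := hv
      _ = _ := by
        congr 1
        ext t
        have heq : c * κ / 2 * m * (c / survivalProb ν m) = η * m / survivalProb ν m := by
          rw [hη]; ring
        rw [Set.mem_ofPred_eq, Set.mem_ofPred_eq, heq]

/-- For every `K`, the volume of the first `N` generations is, with probability comparable to that
of survival, at least `K` times its typical order given survival. -/
theorem InStableDomain.exists_le_gwLaw (hα : 1 < α) (hν : IsCritical ν) (h : InStableDomain α ν)
    (lam : ℝ) (hlam : 0 ≤ lam) :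
    ∃ ε b : ℝ, 0 < ε ∧ 0 < b ∧ ∀ᶠ N : ℕ in atTop,
      ENNReal.ofReal (ε * survivalProb ν N) ≤ gwLaw ν
        {t | lam * N / survivalProb ν N + 1 ≤ (t.upToFinset N).card ∧
          b / survivalProb ν N ≤ t.genSize N} := by
  obtain ⟨hanti, hlim, -⟩ := h.survivalProb_regular hα hν
  obtain ⟨κ, η, hκ, hη, hev⟩ := h.exists_large hα hν
  -- Chosen so that `K η m / p_m` dominates `lam N / p_N + 1`, given `N ≤ 4 m` and `p_N ≥ κ p_m`.
  obtain ⟨K, hK⟩ := exists_nat_ge ((4 * lam / κ + 1) / η)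
  rw [div_le_iff₀ hη] at hK
  set d : ℝ := 1 - Real.exp (-(η ^ 2 / (2 * (K + 1)))) with hd
  have hdpos : 0 < d := sub_pos.2 (Real.exp_lt_one_iff.2 (neg_lt_zero.2 (by positivity)))
  have hsmall : ∀ᶠ m : ℕ in atTop, survivalProb ν m < η / (2 * (K + 1)) :=
    hlim.eventually_lt_const (by positivity)
  obtain ⟨m₀, hm₀⟩ := eventually_atTop.1 ((hev.and hsmall).and (eventually_ge_atTop 2))
  refine ⟨d ^ (K + 1) * η, η * κ, by positivity, by positivity, ?_⟩
  filter_upwards [eventually_ge_atTop (3 * m₀)] with N hN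
  obtain ⟨⟨⟨hreg, hlev, hvol⟩, hp⟩, hm2⟩ := hm₀ (N / 3) (by omega)
  -- `N = (m + r) + 2 m` with `r ≤ 2`: the blocks start at generation `m + r` and have exactly `2 m`
  -- further generations.
  set m := N / 3 with hm
  set p := survivalProb ν m with hpdef
  have hp0 : 0 < p := survivalProb_pos hν m
  have hpN0 : 0 < survivalProb ν N := survivalProb_pos hν N
  have hp1 : p ≤ 1 := survivalProb_le_one ν m
  have hpN : κ * p ≤ survivalProb ν N := by
    have := hreg (N - m) (by omega)
    rwa [show m + (N - m) = N by omega] at this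
  have hpNle : survivalProb ν N ≤ p := hanti (by omega)
  set r := N - 3 * m with hr
  have hr2 : r ≤ m := by omega
  -- `K + 1` blocks of this size fit into the `η / p` individuals available. Because `p` is small
  -- the floor loses at most half, so a block contains a good tree with probability at least `d`,
  -- whatever `N`.
  set B := ⌊η / (p * (K + 1))⌋₊ with hB
  have hqB : η ^ 2 / (2 * (K + 1)) ≤ η * p * B := by
    have h1 := Nat.lt_floor_add_one (η / (p * (K + 1)))
    rw [← hB] at h1
    have h2 : 1 ≤ η / (2 * (p * (K + 1))) := by
      rw [le_div_iff₀ (by positivity)]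
      rw [lt_div_iff₀ (by positivity)] at hp
      linarith
    have h3 : η / (p * (K + 1)) = 2 * (η / (2 * (p * (K + 1)))) := by
      field_simp
    have h4 : η / (2 * (p * (K + 1))) ≤ B := by linarith
    calc η ^ 2 / (2 * (K + 1)) = η * p * (η / (2 * (p * (K + 1)))) := by
          field_simp
      _ ≤ η * p * B := by gcongr
  have hBn : ((K + 1) * B : ℕ) ≤ η / p := by
    have h1 := Nat.floor_le (show 0 ≤ η / (p * (K + 1)) by positivity)
    rw [← hB] at h1
    push_cast
    calc (K + 1 : ℝ) * B ≤ (K + 1) * (η / (p * (K + 1))) := by gcongr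
      _ = η / p := by field_simp
  have hdB : ∀ A : Set (ℕ → ℕ), MeasurableSet A → (∀ x y, x ∈ A → x + y ∈ A) →
      η * p ≤ (gwLaw ν).real {t | t.genSize ∈ A} →
      ENNReal.ofReal d ≤ convPow (pathLaw ν) B A := by
    intro A hA hinc hq
    have hq' : η * p ≤ (pathLaw ν).real A := by
      rw [pathLaw, map_measureReal_apply measurable_genSize' hA]
      exact hq
    refine le_trans (ENNReal.ofReal_le_ofReal ?_) (le_convPow_of_increasing hA hinc hq' B)
    rw [hd]
    gcongr
  have hd1 := hdB {x | η * m / p ≤ ∑ j ∈ Finset.range (2 * m), (x j : ℝ)}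
    (measurableSet_le measurable_const (measurable_sum_range _))
    (fun x y hx => by
      have hx' : η * m / p ≤ ∑ j ∈ Finset.range (2 * m), (x j : ℝ) := hx
      exact hx'.trans (Finset.sum_le_sum fun j _ => by simp)) hvol
  have hd2 := hdB {x | η / p ≤ (x (2 * m) : ℝ)}
    (measurableSet_le measurable_const
      ((Measurable.of_discrete (f := fun k : ℕ => (k : ℝ))).comp (measurable_pi_apply _)))
    (fun x y hx => by
      have hx' : η / p ≤ (x (2 * m) : ℝ) := hx
      exact hx'.trans (by simp)) (by
      have := hlev m le_rfl
      rwa [← two_mul] at this)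
  set F : Set (ℕ → ℕ) := {x | K * (η * m / p) ≤ ∑ j ∈ Finset.range (2 * m), (x j : ℝ) ∧
    η / p ≤ (x (2 * m) : ℝ)} with hF
  have hFm : MeasurableSet F :=
    (measurableSet_le measurable_const (measurable_sum_range _)).inter
      (measurableSet_le measurable_const
        ((Measurable.of_discrete (f := fun k : ℕ => (k : ℝ))).comp (measurable_pi_apply _)))
  set A := {t : FamilyTree | η / p ≤ t.genSize (m + r)} with hA
  have hAm : MeasurableSet A := measurableSet_le measurable_const
    ((Measurable.of_discrete (f := fun k : ℕ => (k : ℝ))).comp (measurable_genSize _))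
  -- The branching property at generation `m + r`, restricted to trees with at least `η / p`
  -- individuals there.
  have hmain : ENNReal.ofReal d ^ (K + 1) * gwLaw ν A ≤
      gwLaw ν {t | (fun j => t.genSize (m + r + j)) ∈ F} := by
    rw [gwLaw_shift ν (m + r) hFm, ← setLIntegral_const]
    refine (setLIntegral_mono' hAm fun t ht => ?_).trans (setLIntegral_le_lintegral A _)
    refine pow_le_convPow_sum_and hd1 hd2 K ?_
    have : η / p ≤ t.genSize (m + r) := ht
    exact_mod_cast hBn.trans this
  calc ENNReal.ofReal (d ^ (K + 1) * η * survivalProb ν N)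
      ≤ ENNReal.ofReal (d ^ (K + 1) * (η * p)) := by
        rw [mul_assoc]; gcongr
    _ = ENNReal.ofReal d ^ (K + 1) * ENNReal.ofReal (η * p) := by
        rw [ENNReal.ofReal_mul (by positivity), ENNReal.ofReal_pow hdpos.le]
    _ ≤ ENNReal.ofReal d ^ (K + 1) * gwLaw ν A := by
        gcongr
        rw [← ofReal_measureReal]
        exact ENNReal.ofReal_le_ofReal (hlev r hr2)
    _ ≤ _ := hmain
    _ ≤ _ := by
        refine measure_mono fun t ht => ⟨?_, ?_⟩
        · have hN4 : (N : ℝ) ≤ 4 * m := by exact_mod_cast (by omega : N ≤ 4 * m)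
          have hm1 : (1 : ℝ) ≤ m := by exact_mod_cast (by omega : 1 ≤ m)
          calc lam * N / survivalProb ν N + 1 ≤ lam * (4 * m) / (κ * p) + m / p := by
                gcongr
                rw [le_div_iff₀ hp0]
                linarith
            _ = (4 * lam / κ + 1) * (m / p) := by field_simp
            _ ≤ K * η * (m / p) := by gcongr
            _ = K * (η * m / p) := by ring
            _ ≤ _ := ht.1
            _ ≤ (t.upToFinset N).card := by
                have := t.sum_genSize_le (m := m + r) (k := 2 * m) (N := N) (by omega)
                exact_mod_cast this
        · have h1 : η / p ≤ t.genSize (m + r + 2 * m) := ht.2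
          rw [show m + r + 2 * m = N by omega] at h1
          refine le_trans ?_ h1
          rw [div_le_div_iff₀ hpN0 hp0]
          calc η * κ * p = η * (κ * p) := mul_assoc _ _ _
            _ ≤ η * survivalProb ν N := by gcongr

/-- The volume of the first `N` generations of the incipient infinite cluster exceeds any multiple
of `N / p_N` with probability bounded from below. -/
theorem InStableDomain.exists_le_iicLaw (hα : 1 < α) (hν : IsCritical ν) (h : InStableDomain α ν)
    (lam : ℝ) (hlam : 0 ≤ lam) :
    ∃ ε : ℝ, 0 < ε ∧ ∀ᶠ N : ℕ in atTop, ENNReal.ofReal ε ≤ iicLaw ν hν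
      {t | lam * N / survivalProb ν N + 1 ≤ (t.upToFinset N).card ∧ 0 < t.genSize N} := by
  obtain ⟨ε, b, hε, hb, hev⟩ := h.exists_le_gwLaw hα hν lam hlam
  refine ⟨b * ε, by positivity, ?_⟩
  filter_upwards [hev] with N hN
  set p := survivalProb ν N with hp
  have hp0 : 0 < p := survivalProb_pos hν N
  set B : Set (Finset (List ℕ)) :=
    {s | lam * N / p + 1 ≤ s.card ∧ b / p ≤ countLength N s} with hB
  have hset : {t : FamilyTree | lam * N / p + 1 ≤ (t.upToFinset N).card ∧
      b / p ≤ t.genSize N} = {t | t.upToFinset N ∈ B} := by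
    simp only [genSize_eq_countLength _ le_rfl (j := N)]
    rfl
  rw [hset] at hN
  -- The size-biasing weight `Z_N ≥ b / p` exactly compensates the factor `p` in the Galton–Watson
  -- probability.
  calc ENNReal.ofReal (b * ε) = ENNReal.ofReal (b / p) * ENNReal.ofReal (ε * p) := by
        rw [← ENNReal.ofReal_mul (by positivity)]
        congr 1
        field_simp
    _ ≤ ENNReal.ofReal (b / p) * gwLaw ν {t | t.upToFinset N ∈ B} := by gcongr
    _ = ∫⁻ _ in {t | t.upToFinset N ∈ B}, ENNReal.ofReal (b / p) ∂(gwLaw ν) :=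
        (setLIntegral_const _ _).symm
    _ ≤ ∫⁻ t in {t | t.upToFinset N ∈ B}, t.genSize N ∂(gwLaw ν) := by
        refine setLIntegral_mono ((Measurable.of_discrete (f := fun k : ℕ => (k : ℝ≥0∞))).comp
          (measurable_genSize N)) fun t ht => ?_
        have h1 : b / p ≤ countLength N (t.upToFinset N) := ht.2
        rw [← genSize_eq_countLength _ le_rfl] at h1
        rw [← ENNReal.ofReal_natCast]
        exact ENNReal.ofReal_le_ofReal h1
    _ = iicLaw ν hν {t | t.upToFinset N ∈ B} :=
        ((isIICLaw_iicLaw ν hν).apply_upToFinset N B).symm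
    _ ≤ _ := by
        rw [← hset]
        refine measure_mono fun t ht => ⟨ht.1, ?_⟩
        have h1 : (0 : ℝ) < t.genSize N := (div_pos hb hp0).trans_le ht.2
        exact_mod_cast h1

end LargeTrees

/-! ### Conclusion -/

theorem proposition3p8 (α : ℝ) (hα1 : 1 < α) (hα2 : α ≤ 2)
    (ν : PMF ℕ) (hcrit : IsCritical ν) (hstable : InStableDomain α ν)
    (ℓ : ℕ → ℝ) (hℓ : ∀ N : ℕ, 1 ≤ N → survivalProb ν N = (N : ℝ) ^ (-(1 / (α - 1))) * ℓ N)
    (lam : ℝ) (hlam : 1 ≤ lam) :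
    0 < liminf (fun N : ℕ => iicLaw ν hcrit {t : FamilyTree |
      ENNReal.ofReal lam ≤ coverTime (t.graphUpTo N) *
        ENNReal.ofReal ((N : ℝ) ^ (-((2 * α - 1) / (α - 1))) * ℓ N)}) atTop := by
  obtain ⟨ε, hε, hev⟩ := hstable.exists_le_iicLaw hα1 hcrit lam (by linarith)
  refine (ENNReal.ofReal_pos.2 hε).trans_le (le_liminf_of_le (by isBoundedDefault) ?_)
  filter_upwards [hev, eventually_ge_atTop 1] with N hN hN1
  refine hN.trans (measure_mono fun t ht => ?_)
  obtain ⟨hvol, hpos⟩ := ht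
  have hNpos : (0 : ℝ) < N := by exact_mod_cast hN1
  have hp0 := survivalProb_pos hcrit N
  -- The exponent is `(2 α - 1)/(α - 1) = 1/(α - 1) + 2`: the first part recovers `p_N`, and the
  -- second matches volume times depth.
  have hscale : (N : ℝ) ^ (-((2 * α - 1) / (α - 1))) * ℓ N = survivalProb ν N / N ^ 2 := by
    have hexp : -((2 * α - 1) / (α - 1)) = -(1 / (α - 1)) - (2 : ℕ) := by
      have : α - 1 ≠ 0 := by linarith
      field_simp
      push_cast; ring
    rw [hexp, Real.rpow_sub_natCast hNpos.ne', hℓ N hN1]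
    ring
  have hcard : (t.upToFinset N).card = (t.upTo N).ncard := by
    rw [Set.ncard_eq_toFinset_card _ (t.finite_upTo N), upToFinset]
  have hcov := t.ofReal_edges_mul_le_coverTime N ((Set.ncard_pos (t.finite_level N)).1 hpos)
  rw [Set.mem_ofPred_eq, hscale]
  refine le_trans ?_ (mul_le_mul_left hcov _)
  rw [← ENNReal.ofReal_mul' (by positivity)]
  refine ENNReal.ofReal_le_ofReal ?_
  rw [hcard] at hvol
  have h1 : lam * N / survivalProb ν N ≤ ((t.upTo N).ncard : ℝ) - 1 := by linarith
  rw [div_le_iff₀ hp0] at h1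
  have h2 : (((t.upTo N).ncard : ℝ) - 1) * N * (survivalProb ν N / N ^ 2) =
      (((t.upTo N).ncard : ℝ) - 1) * survivalProb ν N / N := by
    field_simp
  rw [h2, le_div_iff₀ hNpos]
  exact h1
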